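/- Let $F$ be the Thompson group: its elements are the equivalence classes of pairs $(T_+,T_-)$ of rooted planar binary trees with the same number of leaves, up to insertion and removal of pairs of opposing carets, with the multiplication $(T_+,T)\cdot(T,T_-)=(T_+,T_-)$. Let $x_0$ be the class of (left vine, right vine), each with three leaves, let $x_{i+1}$ be obtained from $x_i$ by hanging both trees on the right leg of a caret, and let $F_+\subset F$ be the monoid generated by $x_0,x_1,x_2,\dots$. Draw $T_-$ upside down below $T_+$, with the leaves identified. The Tait graph $\Gamma(T_+,T_-)$ has one vertex immediately to the left of each leaf, and one edge through each edge of $T_+$ that leads from an inner vertex to its left child and likewise for $T_-$. The oriented Thompson group $\vec F$ consists of the elements of $F$ that are described by a pair with bipartite Tait graph; put $\vec F_+=\vec F\cap F_+$. If $\Gamma(T_+,T_-)$ is bipartite, the oriented link $\vec{\mathcal L}(T_+,T_-)$ has the following diagram: add an edge to each inner vertex of $T_+$ (of $T_-$) that leaves it downwards (upwards) between its two legs, connect the added edges of the two trees between consecutive leaves, join the two roots by an arc on the left, and turn each (now 4-valent) vertex into a crossing, in which the arc formed by the two legs of the caret passes over the strand from the root to the added edge. The vertices of $\Gamma(T_+,T_-)$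 lie in the black regions of the checkerboard colouring with white unbounded region; colour them properly by $+$ and $-$ with $+$ for the leftmost one, and orient the link as the boundary of the black surface, with $+$ regions oriented counterclockwise and $-$ regions clockwise. For a rooted plane tree $U$ whose inner vertices all have three children, let $\alpha(U)$ be the binary tree obtained by replacing each inner vertex by a caret with a second caret on its right leg. **Theorem.** Let $g\in\vec F_+$. 1. Every pair of trees $(T_+,T_-)$ that describes $g$ has a bipartite Tait graph, and the oriented link $\vec{\mathcal L}(T_+,T_-)$ has a positive diagram, that is, a diagram all of whose crossings are positive. 2. There is a ternary tree $U$ such that $g$ is described by $(\alpha(U),V)$, where $V$ is the right vine with the same number of leaves as $\alpha(U)$. For every such $U$, the oriented link $\vec{\mathcal L}(\alpha(U),V)$ has a positive diagram with at most as many crossings as $U$ has right leaves, that is, leaves that are the right child of their parent. -/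

import Mathlib

/-- Rooted planar binary trees. -/
inductive BTree : Type
  | leaf : BTree
  | node : BTree → BTree → BTree
  deriving DecidableEq

namespace BTree

/-- The number of leaves. The leaves are numbered `0, 1, 2, …` from left to right. -/
def leaves : BTree → ℕ
  | leaf => 1
  | node l r => l.leaves + r.leaves

theorem leaves_pos (T : BTree) : 0 < T.leaves := by
  induction T with
  | leaf => simp [leaves]
  | node l r hl hr => simp only [leaves]; omega

/-- `T.graft f` attaches the tree `f i` to the `i`-th leaf of `T`, for every leaf of `T`. -/
def graft : BTree → (ℕ → BTree) → BTree
  | leaf, f => f 0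
  | node l r, f => node (l.graft f) (r.graft fun k => f (k + l.leaves))

/-- The forest with one caret, at position `i`, all other trees being trivial. -/
def caretAt (i : ℕ) : ℕ → BTree := fun k => if k = i then node leaf leaf else leaf

theorem graft_congr (T : BTree) : ∀ {f g : ℕ → BTree}, (∀ i < T.leaves, f i = g i) →
    T.graft f = T.graft g := by
  induction T with
  | leaf => intro f g h; exact h 0 (by simp [leaves])
  | node l r hl hr =>
    intro f g h
    simp only [leaves] at h
    simp only [graft]
    rw [hl (fun i hi => h i (by omega)), hr (fun i hi => h (i + l.leaves) (by omega))]

theorem graft_cancel (T : BTree) : ∀ {f g : ℕ → BTree}, T.graft f = T.graft g →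
    ∀ i < T.leaves, f i = g i := by
  induction T with
  | leaf =>
    intro f g h i hi
    have : i = 0 := by simp [leaves] at hi; exact hi
    subst this; exact h
  | node l r hl hr =>
    intro f g h i hi
    simp only [graft, node.injEq] at h
    simp only [leaves] at hi
    by_cases hil : i < l.leaves
    · exact hl h.1 i hil
    · have := hr h.2 (i - l.leaves) (by omega)
      simpa [Nat.sub_add_cancel (not_lt.mp hil)] using this

theorem graft_leaf (T : BTree) : T.graft (fun _ => leaf) = T := by
  induction T with
  | leaf => rfl
  | node l r hl hr => simp [graft, hl, hr]

/-- The total number of leaves of the trees `f 0, …, f (i - 1)`. -/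
def offset (f : ℕ → BTree) (i : ℕ) : ℕ := ∑ j ∈ Finset.range i, (f j).leaves

theorem offset_add (f : ℕ → BTree) (p i : ℕ) :
    offset f (i + p) = offset f p + offset (fun k => f (k + p)) i := by
  simp only [offset]
  rw [add_comm i p, Finset.sum_range_add]
  simp [add_comm]

theorem leaves_graft (T : BTree) : ∀ f : ℕ → BTree, (T.graft f).leaves = offset f T.leaves := by
  induction T with
  | leaf => intro f; simp [graft, leaves, offset]
  | node l r hl hr =>
    intro f
    simp only [graft, leaves]
    rw [hl, hr, add_comm l.leaves, offset_add]

/-- Composition of forests. -/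
def forestComp (f g : ℕ → BTree) : ℕ → BTree := fun i => (f i).graft fun k => g (k + offset f i)

theorem graft_graft (T : BTree) : ∀ f g : ℕ → BTree,
    (T.graft f).graft g = T.graft (forestComp f g) := by
  induction T with
  | leaf => intro f g; simp [graft, forestComp, offset]
  | node l r hl hr =>
    intro f g
    simp only [graft]
    rw [hl, hr, leaves_graft]
    congr 1
    apply graft_congr
    intro i _
    simp only [forestComp]
    apply graft_congr
    intro k _
    rw [offset_add]
    congr 1
    omega

/-- The forest that has to be grafted on `S` to obtain the smallest common expansion of
`S` and `T`. -/
def residue : BTree → BTree → ℕ → BTree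
  | leaf, T => fun _ => T
  | node _ _, leaf => fun _ => leaf
  | node a b, node c d => fun k =>
      if k < a.leaves then residue a c k else residue b d (k - a.leaves)

theorem graft_residue (S : BTree) : ∀ T : BTree,
    S.graft (residue S T) = T.graft (residue T S) := by
  induction S with
  | leaf =>
    intro T
    cases T with
    | leaf => rfl
    | node c d => simp only [graft, residue]; exact (graft_leaf _).symm
  | node a b ha hb =>
    intro T
    cases T with
    | leaf => simp only [graft, residue]; exact graft_leaf (node a b)
    | node c d =>
      simp only [graft, residue]
      congr 1
      · rw [graft_congr a (g := residue a c) (fun i hi => by simp [hi]),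
          graft_congr c (g := residue c a) (fun i hi => by simp [hi]), ha]
      · rw [graft_congr b (g := residue b d) (fun i hi => by simp),
          graft_congr d (g := residue d b) (fun i hi => by simp), hb]

/-- The right vine with `n + 1` leaves: the bottom tree of a positive element. -/
def vine : ℕ → BTree
  | 0 => leaf
  | n + 1 => node leaf (vine n)

theorem leaves_vine (n : ℕ) : (vine n).leaves = n + 1 := by
  induction n with
  | zero => rfl
  | succ n ih => simp only [vine, leaves, ih]; omega

end BTree

/-- A pair `(T₊, T₋)` of rooted planar binary trees with the same number of leaves. The bottom
tree is drawn upside down below the top tree, with the leaves identified. -/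
structure TreePair : Type where
  top : BTree
  bot : BTree
  leaves_eq : top.leaves = bot.leaves

namespace TreePair

/-- Graft the same forest on both trees of a pair. -/
def graft (P : TreePair) (f : ℕ → BTree) : TreePair :=
  ⟨P.top.graft f, P.bot.graft f, by rw [BTree.leaves_graft, BTree.leaves_graft, P.leaves_eq]⟩

/-- `P.AddCarets Q`: the pair `Q` is obtained from `P` by inserting a pair of opposing carets at
one of the leaves. -/
def AddCarets (P Q : TreePair) : Prop := ∃ i < P.top.leaves, Q = P.graft (BTree.caretAt i)

/-- Equivalence of pairs of trees: generated by insertion and removal of pairs of opposing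
carets. -/
instance setoid : Setoid TreePair := Relation.EqvGen.setoid AddCarets

@[ext] theorem ext' {P Q : TreePair} (h : P.top = Q.top) (h' : P.bot = Q.bot) : P = Q := by
  cases P; cases Q; simp_all

theorem equiv_graft_aux (N : ℕ) : ∀ (P : TreePair) (f : ℕ → BTree),
    BTree.offset f P.top.leaves ≤ P.top.leaves + N → P ≈ P.graft f := by
  induction N with
  | zero =>
    intro P f h
    have hf : ∀ i < P.top.leaves, f i = BTree.leaf := by
      intro i hi
      have h1 : ∀ j ∈ Finset.range P.top.leaves, 1 ≤ (f j).leaves :=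
        fun j _ => BTree.leaves_pos _
      have h2 : ∑ j ∈ Finset.range P.top.leaves, 1 = BTree.offset f P.top.leaves := by
        apply le_antisymm
        · exact Finset.sum_le_sum h1
        · simpa using h
      have h3 := (Finset.sum_eq_sum_iff_of_le h1).mp h2 i (Finset.mem_range.mpr hi)
      cases hfi : f i with
      | leaf => rfl
      | node a b =>
        rw [hfi] at h3
        have := a.leaves_pos
        have := b.leaves_pos
        simp only [BTree.leaves] at h3
        omega
    have : P.graft f = P := by
      apply ext'
      · exact (BTree.graft_congr _ hf).trans (BTree.graft_leaf _)
      · exact (BTree.graft_congr _ (fun i hi => hf i (P.leaves_eq ▸ hi))).trans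
          (BTree.graft_leaf _)
    rw [this]
  | succ N ih =>
    intro P f h
    by_cases hf : ∀ i < P.top.leaves, f i = BTree.leaf
    · have : P.graft f = P := by
        apply ext'
        · exact (BTree.graft_congr _ hf).trans (BTree.graft_leaf _)
        · exact (BTree.graft_congr _ (fun i hi => hf i (P.leaves_eq ▸ hi))).trans
            (BTree.graft_leaf _)
      rw [this]
    · push Not at hf
      obtain ⟨i, hi, hfi⟩ := hf
      obtain ⟨a, b, hab⟩ : ∃ a b, f i = BTree.node a b := by
        cases hc : f i with
        | leaf => exact absurd hc hfi
        | node a b => exact ⟨a, b, rfl⟩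
      let f' : ℕ → BTree := fun k =>
        if k < i then f k else if k = i then a else if k = i + 1 then b else f (k - 1)
      have hoff : ∀ k, BTree.offset (BTree.caretAt i) k = if k ≤ i then k else k + 1 := by
        intro k
        induction k with
        | zero => simp [BTree.offset]
        | succ k ihk =>
          rw [BTree.offset, Finset.sum_range_succ, ← BTree.offset, ihk]
          simp only [BTree.caretAt]
          split_ifs <;> simp only [BTree.leaves] <;> omega
      have hcomp : BTree.forestComp (BTree.caretAt i) f' = f := by
        funext k
        simp only [BTree.forestComp, hoff]
        by_cases hk : k = i
        · subst hk
          have h4 : 1 + k = k + 1 := by omega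
          simp [BTree.caretAt, BTree.graft, BTree.leaves, f', hab, h4]
        · simp only [BTree.caretAt, if_neg hk, BTree.graft, f']
          by_cases hki : k ≤ i
          · have : k < i := by omega
            simp [hki, this]
          · have h1 : ¬ (k + 1 < i) := by omega
            have h2 : ¬ (k + 1 = i) := by omega
            simp [hki, h1, h2, hk]
      have hg : P.graft f = (P.graft (BTree.caretAt i)).graft f' := by
        apply ext'
        · simp only [graft]; rw [BTree.graft_graft, hcomp]
        · simp only [graft]; rw [BTree.graft_graft, hcomp]
      have hstep : P ≈ P.graft (BTree.caretAt i) := Relation.EqvGen.rel _ _ ⟨i, hi, rfl⟩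
      rw [hg]
      refine Setoid.trans hstep (ih _ _ ?_)
      have e1 : BTree.offset f' (P.graft (BTree.caretAt i)).top.leaves
          = BTree.offset f P.top.leaves := by
        rw [← BTree.leaves_graft, ← BTree.leaves_graft]
        have := congrArg (fun Q => BTree.leaves (TreePair.top Q)) hg
        simpa [graft] using this.symm
      have e2 : (P.graft (BTree.caretAt i)).top.leaves = P.top.leaves + 1 := by
        simp only [graft, BTree.leaves_graft, hoff]
        rw [if_neg (by omega)]
      rw [e1, e2]; omega

theorem equiv_graft (P : TreePair) (f : ℕ → BTree) : P ≈ P.graft f :=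
  equiv_graft_aux (BTree.offset f P.top.leaves) P f (by omega)

theorem graft_graft (P : TreePair) (f g : ℕ → BTree) :
    (P.graft f).graft g = P.graft (BTree.forestComp f g) :=
  ext' (BTree.graft_graft _ _ _) (BTree.graft_graft _ _ _)

theorem exists_graft_eq {P Q : TreePair} (h : P ≈ Q) : ∃ f g, P.graft f = Q.graft g := by
  have leaf_graft : ∀ P : TreePair, P.graft (fun _ => BTree.leaf) = P := fun P =>
    ext' (BTree.graft_leaf _) (BTree.graft_leaf _)
  change Relation.EqvGen AddCarets P Q at h
  induction h with
  | rel P Q h =>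
    obtain ⟨i, _, rfl⟩ := h
    exact ⟨BTree.caretAt i, fun _ => BTree.leaf, (leaf_graft _).symm⟩
  | refl P => exact ⟨fun _ => BTree.leaf, fun _ => BTree.leaf, rfl⟩
  | symm P Q _ ih => obtain ⟨f, g, h⟩ := ih; exact ⟨g, f, h.symm⟩
  | trans P Q R _ _ ih1 ih2 =>
    obtain ⟨f, g, h1⟩ := ih1
    obtain ⟨f', g', h2⟩ := ih2
    have hd := BTree.graft_residue (Q.top.graft g) (Q.top.graft f')
    set u := BTree.residue (Q.top.graft g) (Q.top.graft f')
    set v := BTree.residue (Q.top.graft f') (Q.top.graft g)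
    rw [BTree.graft_graft, BTree.graft_graft] at hd
    have hc := BTree.graft_cancel _ hd
    have hQ : (Q.graft g).graft u = (Q.graft f').graft v := by
      rw [graft_graft, graft_graft]
      exact ext' hd (BTree.graft_congr _ fun i hi => hc i (Q.leaves_eq ▸ hi))
    exact ⟨BTree.forestComp f u, BTree.forestComp g' v, by
      rw [← graft_graft, ← graft_graft, h1, hQ, h2]⟩

/-- The product of pairs with matching inner trees respects equivalence. -/
theorem equiv_of_matching {R S T R' S' T' : BTree} (h1 : R.leaves = S.leaves)
    (h2 : S.leaves = T.leaves) (h1' : R'.leaves = S'.leaves) (h2' : S'.leaves = T'.leaves)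
    (hP : (⟨R, S, h1⟩ : TreePair) ≈ ⟨R', S', h1'⟩)
    (hQ : (⟨S, T, h2⟩ : TreePair) ≈ ⟨S', T', h2'⟩) :
    (⟨R, T, h1.trans h2⟩ : TreePair) ≈ ⟨R', T', h1'.trans h2'⟩ := by
  obtain ⟨f, g, hfg⟩ := exists_graft_eq hP
  obtain ⟨f2, g2, hfg2⟩ := exists_graft_eq hQ
  simp only [graft, mk.injEq] at hfg hfg2
  have hd := BTree.graft_residue (S.graft f) (S.graft f2)
  set u := BTree.residue (S.graft f) (S.graft f2)
  set v := BTree.residue (S.graft f2) (S.graft f)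
  have hd' := hd
  rw [hfg.2, hfg2.1] at hd'
  rw [BTree.graft_graft, BTree.graft_graft] at hd hd'
  have hc := BTree.graft_cancel _ hd
  have hc' := BTree.graft_cancel _ hd'
  refine Setoid.trans (equiv_graft _ (BTree.forestComp f u))
    (Setoid.trans ?_ (Setoid.symm (equiv_graft _ (BTree.forestComp g u))))
  have : (⟨R, T, h1.trans h2⟩ : TreePair).graft (BTree.forestComp f u)
      = (⟨R', T', h1'.trans h2'⟩ : TreePair).graft (BTree.forestComp g u) := by
    apply ext'
    · simp only [graft]
      rw [← BTree.graft_graft, ← BTree.graft_graft, hfg.1]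
    · simp only [graft]
      rw [BTree.graft_congr T (fun i hi => hc i (h2.symm ▸ hi)),
        BTree.graft_congr T' (fun i hi => hc' i (h2'.symm ▸ hi)),
        ← BTree.graft_graft, ← BTree.graft_graft, hfg2.2]
  rw [this]

/-- The product of two pairs: expand both so that the bottom tree of the first one equals the top
tree of the second one, and apply `(R, S) · (S, T) = (R, T)`. -/
def mul (P Q : TreePair) : TreePair :=
  ⟨P.top.graft (BTree.residue P.bot Q.top), Q.bot.graft (BTree.residue Q.top P.bot), by
    rw [BTree.leaves_graft, P.leaves_eq, ← BTree.leaves_graft, BTree.graft_residue,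
      BTree.leaves_graft, BTree.leaves_graft, Q.leaves_eq]⟩

theorem mul_equiv_of_matching {R S T : BTree} (h1 : R.leaves = S.leaves)
    (h2 : S.leaves = T.leaves) {P Q : TreePair} (hP : P ≈ ⟨R, S, h1⟩) (hQ : Q ≈ ⟨S, T, h2⟩) :
    mul P Q ≈ ⟨R, T, h1.trans h2⟩ := by
  have e := BTree.graft_residue P.bot Q.top
  have hl : (P.bot.graft (BTree.residue P.bot Q.top)).leaves
      = (Q.bot.graft (BTree.residue Q.top P.bot)).leaves := by
    rw [e, BTree.leaves_graft, BTree.leaves_graft, Q.leaves_eq]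
  refine equiv_of_matching (S := P.bot.graft (BTree.residue P.bot Q.top))
    (P.graft _).leaves_eq hl h1 h2
    (Setoid.trans (Setoid.symm (equiv_graft P _)) hP) ?_
  refine Setoid.trans ?_ hQ
  have : (⟨P.bot.graft (BTree.residue P.bot Q.top), Q.bot.graft (BTree.residue Q.top P.bot), hl⟩ :
      TreePair) = Q.graft (BTree.residue Q.top P.bot) := ext' e rfl
  rw [this]
  exact Setoid.symm (equiv_graft Q _)

/-- Any two pairs can be expanded so that they match. -/
theorem exists_matching (P Q : TreePair) : ∃ (R S T : BTree) (h1 : R.leaves = S.leaves)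
    (h2 : S.leaves = T.leaves), P ≈ ⟨R, S, h1⟩ ∧ Q ≈ ⟨S, T, h2⟩ := by
  have e := BTree.graft_residue P.bot Q.top
  refine ⟨P.top.graft (BTree.residue P.bot Q.top), P.bot.graft (BTree.residue P.bot Q.top),
    Q.bot.graft (BTree.residue Q.top P.bot), (P.graft _).leaves_eq, ?_, equiv_graft P _, ?_⟩
  · rw [e, BTree.leaves_graft, BTree.leaves_graft, Q.leaves_eq]
  · have := equiv_graft Q (BTree.residue Q.top P.bot)
    have h : Q.graft (BTree.residue Q.top P.bot) = ⟨P.bot.graft (BTree.residue P.bot Q.top),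
        Q.bot.graft (BTree.residue Q.top P.bot), by
          rw [e, BTree.leaves_graft, BTree.leaves_graft, Q.leaves_eq]⟩ := ext' e.symm rfl
    rw [← h]; exact this

/-- The inverse pair. -/
def inv (P : TreePair) : TreePair := ⟨P.bot, P.top, P.leaves_eq.symm⟩

theorem inv_equiv {P Q : TreePair} (h : P ≈ Q) : inv P ≈ inv Q := by
  obtain ⟨f, g, e⟩ := exists_graft_eq h
  refine Setoid.trans (equiv_graft _ f) (Setoid.trans ?_ (Setoid.symm (equiv_graft _ g)))
  simp only [graft, mk.injEq] at e
  have : (inv P).graft f = (inv Q).graft g := ext' e.2 e.1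
  rw [this]

end TreePair

/-- The Thompson group `F`: equivalence classes of pairs of trees. -/
def ThompsonF : Type := Quotient TreePair.setoid

namespace ThompsonF

/-- The element of `F` described by a pair of trees. -/
def mk (P : TreePair) : ThompsonF := Quotient.mk TreePair.setoid P

theorem mk_eq {P Q : TreePair} : mk P = mk Q ↔ P ≈ Q := Quotient.eq

instance : Mul ThompsonF := ⟨Quotient.map₂ TreePair.mul (by
  intro P P' hP Q Q' hQ
  obtain ⟨R, S, T, h1, h2, hR, hS⟩ := TreePair.exists_matching P' Q'
  exact Setoid.trans (TreePair.mul_equiv_of_matching h1 h2 (Setoid.trans hP hR)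
    (Setoid.trans hQ hS)) (Setoid.symm (TreePair.mul_equiv_of_matching h1 h2 hR hS)))⟩

instance : One ThompsonF := ⟨mk ⟨BTree.leaf, BTree.leaf, rfl⟩⟩

instance : Inv ThompsonF := ⟨Quotient.map TreePair.inv (fun _ _ h => TreePair.inv_equiv h)⟩

/-- The multiplication rule `(R, S) · (S, T) = (R, T)`. -/
theorem mk_mul_mk {R S T : BTree} (h1 : R.leaves = S.leaves) (h2 : S.leaves = T.leaves) :
    mk ⟨R, S, h1⟩ * mk ⟨S, T, h2⟩ = mk ⟨R, T, h1.trans h2⟩ :=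
  mk_eq.mpr (TreePair.mul_equiv_of_matching h1 h2 (Setoid.refl _) (Setoid.refl _))

theorem mk_self (T : BTree) : mk ⟨T, T, rfl⟩ = 1 :=
  Eq.symm (mk_eq.mpr (TreePair.equiv_graft ⟨BTree.leaf, BTree.leaf, rfl⟩ (fun _ => T)))

theorem exists_matching (a b : ThompsonF) : ∃ (R S T : BTree) (h1 : R.leaves = S.leaves)
    (h2 : S.leaves = T.leaves), a = mk ⟨R, S, h1⟩ ∧ b = mk ⟨S, T, h2⟩ := by
  induction a using Quotient.inductionOn with | _ P
  induction b using Quotient.inductionOn with | _ Q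
  obtain ⟨R, S, T, h1, h2, hP, hQ⟩ := TreePair.exists_matching P Q
  exact ⟨R, S, T, h1, h2, mk_eq.mpr hP, mk_eq.mpr hQ⟩

instance : Group ThompsonF := Group.ofLeftAxioms
  (by
    intro a b c
    obtain ⟨R, S, T, h1, h2, rfl, rfl⟩ := exists_matching a b
    obtain ⟨P, hP⟩ : ∃ P, c = mk P := by
      induction c using Quotient.inductionOn with | _ P
      exact ⟨P, rfl⟩
    subst hP
    have e := BTree.graft_residue T P.top
    set f := BTree.residue T P.top
    set g := BTree.residue P.top T
    have k1 : (R.graft f).leaves = (S.graft f).leaves := by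
      rw [BTree.leaves_graft, BTree.leaves_graft, h1]
    have k2 : (S.graft f).leaves = (T.graft f).leaves := by
      rw [BTree.leaves_graft, BTree.leaves_graft, h2]
    have k3 : (T.graft f).leaves = (P.bot.graft g).leaves := by
      rw [e, BTree.leaves_graft, BTree.leaves_graft, P.leaves_eq]
    have a1 : mk ⟨R, S, h1⟩ = mk ⟨R.graft f, S.graft f, k1⟩ :=
      mk_eq.mpr (TreePair.equiv_graft ⟨R, S, h1⟩ f)
    have a2 : mk ⟨S, T, h2⟩ = mk ⟨S.graft f, T.graft f, k2⟩ :=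
      mk_eq.mpr (TreePair.equiv_graft ⟨S, T, h2⟩ f)
    have a3 : mk P = mk ⟨T.graft f, P.bot.graft g, k3⟩ := by
      have : P.graft g = ⟨T.graft f, P.bot.graft g, k3⟩ := TreePair.ext' e.symm rfl
      rw [← this]
      exact mk_eq.mpr (TreePair.equiv_graft P g)
    rw [a1, a2, a3, mk_mul_mk, mk_mul_mk, mk_mul_mk, mk_mul_mk])
  (by
    intro a
    induction a using Quotient.inductionOn with | _ P
    change 1 * mk P = mk P
    rw [← mk_self P.top]
    exact mk_mul_mk rfl P.leaves_eq)
  (by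
    intro a
    induction a using Quotient.inductionOn with | _ P
    change mk ⟨P.bot, P.top, P.leaves_eq.symm⟩ * mk ⟨P.top, P.bot, P.leaves_eq⟩ = 1
    rw [mk_mul_mk, mk_self])

/-- The pair of trees of the generator `x_i`: for `i = 0` a left vine over a right vine, each with
three leaves; passing from `i` to `i + 1` hangs both trees on the right leg of a caret. -/
def genPair : ℕ → TreePair
  | 0 => ⟨.node (.node .leaf .leaf) .leaf, .node .leaf (.node .leaf .leaf), rfl⟩
  | i + 1 => ⟨.node .leaf (genPair i).top, .node .leaf (genPair i).bot, by
      simp only [BTree.leaves, (genPair i).leaves_eq]⟩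

/-- The generator `x_i` of `F`. -/
def x (i : ℕ) : ThompsonF := mk (genPair i)

/-- The monoid `F₊` of positive elements. -/
def positive : Submonoid ThompsonF := Submonoid.closure (Set.range x)

end ThompsonF

/-! ### The Tait graph and the oriented subgroup -/

/-- The edges of the half of the Tait graph that comes from one tree, whose leaves are numbered from
`j` on. Vertex `k` lies directly to the left of leaf `k`. The left leg of a caret with `p` leaves
below its left leg, the first of them being `k`, is crossed by one edge, from `k` to `k + p`. -/
def BTree.taitEdges : BTree → ℕ → List (ℕ × ℕ)
  | .leaf, _ => []
  | .node l r, j => (j, j + l.leaves) :: (l.taitEdges j ++ r.taitEdges (j + l.leaves))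

namespace TreePair

/-- The Tait graph `Γ(T₊, T₋)` (without multiplicities and signs of edges). -/
def tait (P : TreePair) : SimpleGraph (Fin P.top.leaves) :=
  SimpleGraph.fromRel fun a b =>
    ((a : ℕ), (b : ℕ)) ∈ P.top.taitEdges 0 ∨ ((a : ℕ), (b : ℕ)) ∈ P.bot.taitEdges 0

/-- The Tait graph is bipartite. -/
def IsOriented (P : TreePair) : Prop := P.tait.Colorable 2

end TreePair

/-- The elements of the oriented Thompson group. -/
def ThompsonF.oriented : Set ThompsonF := {g | ∃ P : TreePair, ThompsonF.mk P = g ∧ P.IsOriented}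

/-! ### Oriented link diagrams

A diagram in general position with respect to the height function is read from top to bottom as
a sequence of slices, each of which holds one local maximum, local minimum or crossing. -/

/-- The event in a slice. `birth b` is a local maximum, whose left leg points upwards if `b = true`
and downwards if `b = false`; `death` is a local minimum; `cross o` is a crossing, in which
the strand from the upper left to the lower right is the upper one if `o = true`, and the
lower one if `o = false`. -/
inductive LinkEvent : Type
  | birth (b : Bool) : LinkEvent
  | death : LinkEvent
  | cross (o : Bool) : LinkEvent
  deriving DecidableEq

namespace LinkEvent

/-- The number of strands that enter an event from above. -/
def width : LinkEvent → ℕ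
  | birth _ => 0
  | death => 2
  | cross _ => 2

/-- The number of strands that leave an event below. -/
def width' : LinkEvent → ℕ
  | birth _ => 2
  | death => 0
  | cross _ => 2

end LinkEvent

/-- A slice: an event with `pos` vertical strands to the left of it. -/
structure Slice : Type where
  pos : ℕ
  event : LinkEvent
  deriving DecidableEq

namespace Slice

/-- The effect of a slice on the list of strands at a given height, from left to right, where `true`
stands for a strand pointing upwards and `false` for one pointing downwards; `none` if the slice
does not fit. -/
def apply (s : List Bool) : Slice → Option (List Bool)
  | ⟨i, .birth b⟩ => if i ≤ s.length then some (s.take i ++ b :: (!b) :: s.drop i) else none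
  | ⟨i, .death⟩ =>
    match s.drop i with
    | a :: b :: r => if a = !b then some (s.take i ++ r) else none
    | _ => none
  | ⟨i, .cross _⟩ =>
    match s.drop i with
    | a :: b :: r => some (s.take i ++ b :: a :: r)
    | _ => none

/-- The list of signs of the crossings in a slice (at most one): a crossing is positive if
a counterclockwise turn by less than a half turn takes the direction of the upper strand to that
of the lower strand. -/
def signs (s : List Bool) : Slice → List ℤ
  | ⟨i, .cross o⟩ =>
    match s.drop i with
    | a :: b :: _ => [if o = xor a b then 1 else -1]
    | _ => []
  | _ => []

end Slice

/-- Apply a sequence of slices, from top to bottom. -/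
def runSlices : List Slice → List Bool → Option (List Bool)
  | [], s => some s
  | e :: w, s => (e.apply s).bind (runSlices w)

/-- The signs of all the crossings in a sequence of slices, from top to bottom. -/
def signsOfSlices : List Slice → List Bool → List ℤ
  | [], _ => []
  | e :: w, s => e.signs s ++ ((e.apply s).elim [] (signsOfSlices w))

/-- An oriented link diagram. -/
structure LinkDiagram : Type where
  word : List Slice
  closed : runSlices word [] = some []

/-- The local moves: planar isotopies and Reidemeister moves. -/
inductive LocalMove : List Slice → List Slice → Prop
  /-- Two events side by side are interchanged. -/
  | far (i k : ℕ) (e f : LinkEvent) :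
      LocalMove [⟨i, e⟩, ⟨i + e.width' + k, f⟩] [⟨i + e.width + k, f⟩, ⟨i, e⟩]
  /-- A maximum and a minimum cancel. -/
  | zigzag (i : ℕ) (b : Bool) : LocalMove [⟨i, .birth b⟩, ⟨i + 1, .death⟩] []
  | zigzag' (i : ℕ) (b : Bool) : LocalMove [⟨i + 1, .birth b⟩, ⟨i, .death⟩] []
  /-- A strand that crosses one leg of a maximum is made to cross the other leg. -/
  | slideMax (i : ℕ) (b o : Bool) :
      LocalMove [⟨i, .birth b⟩, ⟨i + 1, .cross o⟩] [⟨i + 1, .birth b⟩, ⟨i, .cross !o⟩]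
  /-- A strand that crosses one leg of a minimum is made to cross the other leg. -/
  | slideMin (i : ℕ) (o : Bool) :
      LocalMove [⟨i + 1, .cross o⟩, ⟨i, .death⟩] [⟨i, .cross !o⟩, ⟨i + 1, .death⟩]
  /-- The first Reidemeister move, at a maximum and at a minimum. -/
  | reidemeister₁ (i : ℕ) (b o : Bool) :
      LocalMove [⟨i, .birth b⟩, ⟨i, .cross o⟩] [⟨i, .birth !b⟩]
  | reidemeister₁' (i : ℕ) (o : Bool) : LocalMove [⟨i, .cross o⟩, ⟨i, .death⟩] [⟨i, .death⟩]
  /-- The second Reidemeister move. -/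
  | reidemeister₂ (i : ℕ) (o : Bool) : LocalMove [⟨i, .cross o⟩, ⟨i, .cross !o⟩] []
  /-- The third Reidemeister move. With the strands numbered from left to right at the top, `a`, `b`
  and `c` say whether 1 is above 2, 1 above 3 and 2 above 3; this must not be cyclic. -/
  | reidemeister₃ (i : ℕ) (a b c : Bool) (h : a = c → b = a) :
      LocalMove [⟨i, .cross a⟩, ⟨i + 1, .cross b⟩, ⟨i, .cross c⟩]
        [⟨i + 1, .cross c⟩, ⟨i, .cross b⟩, ⟨i + 1, .cross a⟩]

namespace LinkDiagram

/-- `E` arises from `D` by one local move. -/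
def Move (D E : LinkDiagram) : Prop :=
  ∃ u v l r : List Slice, LocalMove l r ∧ D.word = u ++ l ++ v ∧ E.word = u ++ r ++ v

/-- Two oriented link diagrams represent the same oriented link. -/
def SameLink : LinkDiagram → LinkDiagram → Prop := Relation.EqvGen Move

/-- The signs of the crossings. -/
def signs (D : LinkDiagram) : List ℤ := signsOfSlices D.word []

/-- The number of crossings. -/
def crossings (D : LinkDiagram) : ℕ := D.signs.length

/-- All crossings are positive. -/
def IsPositive (D : LinkDiagram) : Prop := ∀ ε ∈ D.signs, ε = 1

end LinkDiagram

/-! ### The oriented link of a pair of trees -/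

namespace BTree

/-- The upper half of the diagram: each vertex of the top tree gets a fourth edge that leads
downwards, and becomes a crossing of the arc formed by the two legs of the caret, above, and the
strand that comes from the root, below. Here `i` is the number of strands to the left of the edge
from which the tree hangs, `j` the number of leaves to its left, and `c` a colouring of the
vertices of the Tait graph; the left leg is a right-hand boundary of the black region `j`. -/
def topWord (c : ℕ → Bool) : BTree → ℕ → ℕ → List Slice
  | leaf, _, _ => []
  | node l r, i, j => ⟨i, .birth (c j)⟩ :: ⟨i + 1, .cross true⟩ ::
      (l.topWord c i j ++ r.topWord c (i + 2 * l.leaves) (j + l.leaves))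

/-- The lower half of the diagram, for the tree that is drawn upside down; again the arc
formed by the two legs of a caret is above the strand that comes from the root. -/
def botWord : BTree → ℕ → List Slice
  | leaf, _ => []
  | node l r, i => r.botWord (i + 2 * l.leaves) ++ (l.botWord i ++
      [⟨i + 1, .cross false⟩, ⟨i, .death⟩])

/-- The orientations of the strands on both sides of the black regions `j, …, j + n - 1` where they
meet the line between the two trees. A region of colour `true` (that is, `+`) lies to the left of
its boundary, so that its left side points downwards and its right side upwards. -/
def strands (c : ℕ → Bool) : ℕ → ℕ → List Bool
  | _, 0 => []
  | j, n + 1 => (!c j) :: c j :: strands c (j + 1) n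

theorem strands_add (c : ℕ → Bool) (p q : ℕ) : ∀ j,
    strands c j (p + q) = strands c j p ++ strands c (j + p) q := by
  induction p with
  | zero => intro j; simp [strands]
  | succ p ih =>
    intro j
    have e : p + 1 + q = (p + q) + 1 := by omega
    rw [e]
    simp only [strands, ih, List.cons_append]
    rw [show j + 1 + p = j + (p + 1) by omega]

theorem length_strands (c : ℕ → Bool) (n : ℕ) : ∀ j, (strands c j n).length = 2 * n := by
  induction n with
  | zero => intro j; rfl
  | succ n ih => intro j; simp only [strands, List.length_cons, ih]; omega

theorem runSlices_append (u v : List Slice) : ∀ s,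
    runSlices (u ++ v) s = (runSlices u s).bind (runSlices v) := by
  induction u with
  | nil => intro s; rfl
  | cons e u ih =>
    intro s
    simp only [List.cons_append, runSlices]
    cases e.apply s with
    | none => rfl
    | some t => simp [ih]

theorem apply_birth (l r : List Bool) (b : Bool) :
    Slice.apply (l ++ r) ⟨l.length, .birth b⟩ = some (l ++ b :: (!b) :: r) := by
  simp [Slice.apply]

theorem apply_cross (l r : List Bool) (a b o : Bool) :
    Slice.apply (l ++ a :: b :: r) ⟨l.length, .cross o⟩ = some (l ++ b :: a :: r) := by
  simp [Slice.apply]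

theorem apply_death (l r : List Bool) (a : Bool) :
    Slice.apply (l ++ a :: (!a) :: r) ⟨l.length, .death⟩ = some (l ++ r) := by
  simp [Slice.apply]

theorem run_topWord (c : ℕ → Bool) (T : BTree) : ∀ (l r : List Bool) (j : ℕ),
    (∀ e ∈ T.taitEdges j, c e.2 = !c e.1) →
    runSlices (T.topWord c (l.length + 1) j) (l ++ (!c j) :: c j :: r)
      = some (l ++ strands c j T.leaves ++ r) := by
  induction T with
  | leaf => intro l r j _; simp [topWord, runSlices, strands, leaves]
  | node a b ha hb =>
    intro l r j hc
    simp only [taitEdges, List.mem_cons, List.mem_append] at hc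
    have h0 : c (j + a.leaves) = !c j := hc (j, j + a.leaves) (Or.inl rfl)
    have s1 := apply_birth (l ++ [!c j]) (c j :: r) (c j)
    have s2 := apply_cross (l ++ [!c j, c j]) r (!c j) (c j) true
    have s3 := ha l ((!c (j + a.leaves)) :: c (j + a.leaves) :: r) j
      (fun e he => hc e (Or.inr (Or.inl he)))
    have s4 := hb (l ++ strands c j a.leaves) r (j + a.leaves)
      (fun e he => hc e (Or.inr (Or.inr he)))
    simp only [List.length_append, List.length_cons, List.length_nil, List.append_assoc,
      List.cons_append, List.nil_append, zero_add, length_strands] at s1 s2 s3 s4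
    simp only [topWord, runSlices, leaves, strands_add]
    rw [s1]
    simp only [Option.bind_some]
    rw [show l.length + 1 + 1 = l.length + (1 + 1) by omega, s2]
    simp only [Option.bind_some, runSlices_append]
    rw [h0, Bool.not_not] at s3
    rw [s3]
    simp only [Option.bind_some]
    rw [h0, Bool.not_not] at s4
    rw [show l.length + 1 + 2 * a.leaves = l.length + 2 * a.leaves + 1 by omega, s4]
    simp

theorem run_botWord (c : ℕ → Bool) (T : BTree) : ∀ (l r : List Bool) (j : ℕ),
    (∀ e ∈ T.taitEdges j, c e.2 = !c e.1) →
    runSlices (T.botWord (l.length + 1)) (l ++ strands c j T.leaves ++ r)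
      = some (l ++ (!c j) :: c j :: r) := by
  induction T with
  | leaf => intro l r j _; simp [botWord, runSlices, strands, leaves]
  | node a b ha hb =>
    intro l r j hc
    simp only [taitEdges, List.mem_cons, List.mem_append] at hc
    have h0 : c (j + a.leaves) = !c j := hc (j, j + a.leaves) (Or.inl rfl)
    have s1 := apply_death (l ++ [!c j]) (c j :: r) (c j)
    have s2 := apply_cross (l ++ [!c j, c j]) r (c j) (!c j) false
    have s3 := ha l ((!c (j + a.leaves)) :: c (j + a.leaves) :: r) j
      (fun e he => hc e (Or.inr (Or.inl he)))
    have s4 := hb (l ++ strands c j a.leaves) r (j + a.leaves)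
      (fun e he => hc e (Or.inr (Or.inr he)))
    simp only [List.length_append, List.length_cons, List.length_nil, List.append_assoc,
      List.cons_append, List.nil_append, zero_add, length_strands] at s1 s2 s3 s4
    simp only [botWord, leaves, strands_add, runSlices_append]
    rw [show l.length + 1 + 2 * a.leaves = l.length + 2 * a.leaves + 1 by omega]
    simp only [List.append_assoc]
    rw [s4]
    simp only [Option.bind_some]
    rw [s3]
    simp only [Option.bind_some, runSlices]
    rw [h0, Bool.not_not, show l.length + 1 + 1 = l.length + (1 + 1) by omega, s2]
    simp only [Option.bind_some]
    rw [s1]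
    simp

end BTree

namespace TreePair

open Classical in
/-- The proper colouring of the (bipartite) Tait graph with the two colours `+` (`true`) and `-`
(`false`) in which the leftmost vertex has colour `+`. It is the only one, as the graph is
connected. (Junk value `false` beyond the last vertex.) -/
noncomputable def colour (P : TreePair) (h : P.IsOriented) (k : ℕ) : Bool :=
  if hk : k < P.top.leaves then
    decide (h.some ⟨k, hk⟩ = h.some ⟨0, P.top.leaves_pos⟩) else false

theorem colour_zero (P : TreePair) (h : P.IsOriented) : P.colour h 0 = true := by
  simp [colour, P.top.leaves_pos]

theorem taitEdges_lt (T : BTree) : ∀ (j : ℕ), ∀ e ∈ T.taitEdges j,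
    j ≤ e.1 ∧ e.1 < e.2 ∧ e.2 < j + T.leaves := by
  induction T with
  | leaf => intro j e he; simp [BTree.taitEdges] at he
  | node a b ha hb =>
    intro j e he
    have pa := a.leaves_pos
    have pb := b.leaves_pos
    simp only [BTree.taitEdges, List.mem_cons, List.mem_append] at he
    simp only [BTree.leaves]
    rcases he with rfl | he | he
    · refine ⟨le_refl _, ?_, ?_⟩ <;> simp only <;> omega
    · have := ha j e he; omega
    · have := hb _ e he; omega

theorem colour_edge (P : TreePair) (h : P.IsOriented) (e : ℕ × ℕ)
    (he : e ∈ P.top.taitEdges 0 ∨ e ∈ P.bot.taitEdges 0) :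
    P.colour h e.2 = !P.colour h e.1 := by
  have hlt : e.1 < e.2 ∧ e.2 < P.top.leaves := by
    rcases he with he | he
    · have := taitEdges_lt _ _ _ he; omega
    · have := taitEdges_lt _ _ _ he; have := P.leaves_eq; omega
  have h1 : e.1 < P.top.leaves := by omega
  have adj : P.tait.Adj ⟨e.1, h1⟩ ⟨e.2, hlt.2⟩ := by
    rw [tait, SimpleGraph.fromRel_adj]
    refine ⟨?_, Or.inl he⟩
    intro hh
    have := Fin.mk.inj_iff.mp hh
    omega
  have hne := h.some.valid adj
  have two : ∀ x y z : Fin 2, x ≠ y → (decide (y = z) = !decide (x = z)) := by decide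
  have := two _ _ (h.some ⟨0, P.top.leaves_pos⟩) hne
  simp only [colour, h1, hlt.2, dif_pos]
  convert this

/-- The oriented link diagram of a pair of trees with bipartite Tait graph: the roots of the two
trees are joined by an arc on the left of the diagram. -/
noncomputable def link (P : TreePair) (h : P.IsOriented) : LinkDiagram where
  word := ⟨0, .birth (!P.colour h 0)⟩ ::
    (P.top.topWord (P.colour h) 1 0 ++ (P.bot.botWord 1 ++ [⟨0, .death⟩]))
  closed := by
    have s1 := BTree.run_topWord (P.colour h) P.top [] [] 0
      (fun e he => P.colour_edge h e (Or.inl he))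
    have s2 := BTree.run_botWord (P.colour h) P.bot [] [] 0
      (fun e he => P.colour_edge h e (Or.inr he))
    rw [← P.leaves_eq] at s2
    simp only [List.length_nil, List.nil_append, zero_add, List.append_nil] at s1 s2
    simp only [runSlices, BTree.runSlices_append]
    have s0 := BTree.apply_birth [] [] (!P.colour h 0)
    simp only [List.length_nil, List.nil_append] at s0
    rw [Bool.not_not] at s0
    rw [s0]
    simp only [Option.bind_some]
    rw [s1]
    simp only [Option.bind_some]
    rw [BTree.runSlices_append, s2]
    simp [runSlices, Slice.apply]

end TreePair

/-! ### Ternary trees -/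

/-- Rooted plane trees whose inner vertices have three children (so they have valency four). -/
inductive TTree : Type
  | leaf : TTree
  | node : TTree → TTree → TTree → TTree

namespace TTree

/-- The binary transform: each inner vertex is replaced by a binary tree with three leaves, namely
a caret with a second caret on its right leg. -/
def binary : TTree → BTree
  | leaf => .leaf
  | node a b c => .node a.binary (.node b.binary c.binary)

/-- The number of right leaves: the leaves that are the right child of their parent. -/
def rightLeaves : TTree → ℕ
  | leaf => 0
  | node a b leaf => a.rightLeaves + b.rightLeaves + 1
  | node a b c => a.rightLeaves + b.rightLeaves + c.rightLeaves

end TTree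

/-- The pair with top tree `T` whose bottom tree is the right vine. -/
def BTree.toPair (T : BTree) : TreePair :=
  ⟨T, BTree.vine (T.leaves - 1), by
    rw [BTree.leaves_vine, Nat.sub_add_cancel T.leaves_pos]⟩

/-! ### Words of slices as tangles -/

/-! In the diagram of a pair with bipartite Tait graph, the strand from the root of a caret points
the same way as the left leg. Hence all crossings of the top tree are positive and all crossings of
the bottom tree are negative, and the task is to remove the latter by isotopies.

A positive element has a pair whose bottom tree is a right vine
(`ThompsonF.exists_toPair_of_mem_positive`). The vine forces the colours to alternate along the
leaves, so bipartiteness means that every left subtree of the top tree has an odd number of leaves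
(`BTree.isOriented_toPair_iff`). By parity every such subtree is the binary transform of a ternary
tree, and so is the whole tree if its number of leaves is odd (`BTree.exists_binary`).

The vine carets below a right subtree can be moved above the left subtree (`BTree.isotopic_nest`).
The diagram then becomes recursive: a top caret, the right subtree with its share of the vine, the
left subtree with as many vine carets as it has leaves. Negative crossings now sit only where a leaf
meets its vine caret, and three isotopies remove them. At a left child, the two opposing carets form
an arc that slides off (`isotopic_slide_arc`). At a right leaf of a ternary vertex whose middle
child is also a leaf, everything collapses to a minimum (`isotopic_kink`). If the middle child is
not a leaf, the arc is swung over the whole tangle of that child and leaves a single positive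
crossing (`isotopic_turn`, which rests on `isotopic_overpass`). By induction the tangle of a
nontrivial ternary tree needs one crossing fewer than the tree has right leaves
(`TTree.hasPositiveForm_vineTangle`). This saving pays for the positive crossing of a top caret from
which the tree hangs as left child.

An arbitrary pair for the same element shares a reduction with the pair over a vine
(`TreePair.join_of_equiv`), and reductions of pairs over a vine are again over a vine. Going back
up, each inserted pair of opposing carets only adds a circle without crossings
(`TreePair.hasPositiveForm_diagram_graft_caretAt`), so positivity survives. -/

namespace LinkEvent

/-- The effect of an event on the strands that take part in it. -/
inductive Acts : LinkEvent → List Bool → List Bool → Prop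
  | birth (b : Bool) : Acts (.birth b) [] [b, !b]
  | death (a : Bool) : Acts .death [a, !a] []
  | cross (o a b : Bool) : Acts (.cross o) [a, b] [b, a]

theorem Acts.length {e : LinkEvent} {m m' : List Bool} (h : e.Acts m m') :
    m.length = e.width ∧ m'.length = e.width' := by
  cases h <;> simp [width, width']

end LinkEvent

namespace Slice

/-- Separates the local action of an event from the bystanders `l` and `r`. Later arguments treat
the event alone and then frame it. -/
theorem apply_eq_some_iff {s t : List Bool} {i : ℕ} {e : LinkEvent} :
    Slice.apply s ⟨i, e⟩ = some t ↔ ∃ l m m' r : List Bool, l.length = i ∧ s = l ++ m ++ r ∧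
      t = l ++ m' ++ r ∧ e.Acts m m' := by
  constructor
  · intro h
    cases e with
    | birth b =>
      simp only [Slice.apply] at h
      split_ifs at h with hi
      refine ⟨s.take i, [], [b, !b], s.drop i, by simpa using hi, by simp, ?_, .birth b⟩
      simpa using h.symm
    | death =>
      simp only [Slice.apply] at h
      split at h
      · next a b r hd =>
        split_ifs at h with hab
        have hi : i ≤ s.length := by
          by_contra hlt
          rw [List.drop_eq_nil_of_le (by omega)] at hd
          simp at hd
        refine ⟨s.take i, [a, b], [], r, by simpa using hi, ?_, ?_, ?_⟩
        · conv_lhs => rw [← List.take_append_drop i s, hd]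
          simp
        · simpa using h.symm
        · have hb : b = !a := by rw [hab, Bool.not_not]
          rw [hb]; exact .death a
      · simp at h
    | cross o =>
      simp only [Slice.apply] at h
      split at h
      · next a b r hd =>
        have hi : i ≤ s.length := by
          by_contra hlt
          rw [List.drop_eq_nil_of_le (by omega)] at hd
          simp at hd
        refine ⟨s.take i, [a, b], [b, a], r, by simpa using hi, ?_, ?_, .cross o a b⟩
        · conv_lhs => rw [← List.take_append_drop i s, hd]
          simp
        · simpa using h.symm
      · simp at h
  · rintro ⟨l, m, m', r, rfl, rfl, rfl, h⟩
    cases h <;> simp [Slice.apply]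

theorem signs_append (l m r : List Bool) (e : LinkEvent) (h : m.length = e.width) :
    Slice.signs (l ++ m ++ r) ⟨l.length, e⟩ = Slice.signs m ⟨0, e⟩ := by
  cases e with
  | birth b => rfl
  | death => rfl
  | cross o =>
    obtain ⟨a, b, rfl⟩ := List.length_eq_two.mp h
    simp [Slice.signs]

end Slice

/-- Move a word of slices by `k` strands to the right. -/
def shift (k : ℕ) (w : List Slice) : List Slice := w.map fun e => ⟨e.pos + k, e.event⟩

@[simp] theorem shift_nil (k : ℕ) : shift k [] = [] := rfl

@[simp] theorem shift_cons (k i : ℕ) (e : LinkEvent) (w : List Slice) :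
    shift k (⟨i, e⟩ :: w) = ⟨i + k, e⟩ :: shift k w := rfl

@[simp] theorem shift_append (k : ℕ) (u v : List Slice) :
    shift k (u ++ v) = shift k u ++ shift k v := List.map_append

@[simp] theorem shift_zero (w : List Slice) : shift 0 w = w := by simp [shift]

theorem shift_shift (k l : ℕ) (w : List Slice) : shift k (shift l w) = shift (l + k) w := by
  simp [shift, Nat.add_assoc]

theorem LocalMove.shift {l r : List Slice} (h : LocalMove l r) (k : ℕ) :
    LocalMove (shift k l) (shift k r) := by
  cases h with
  | far i j e f =>
    have h := LocalMove.far (i + k) j e f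
    simp only [shift_cons, shift_nil]
    rwa [show i + e.width' + j + k = i + k + e.width' + j by omega,
      show i + e.width + j + k = i + k + e.width + j by omega]
  | zigzag i b => simpa [Nat.add_right_comm i 1 k] using LocalMove.zigzag (i + k) b
  | zigzag' i b => simpa [Nat.add_right_comm i 1 k] using LocalMove.zigzag' (i + k) b
  | slideMax i b o => simpa [Nat.add_right_comm i 1 k] using LocalMove.slideMax (i + k) b o
  | slideMin i o => simpa [Nat.add_right_comm i 1 k] using LocalMove.slideMin (i + k) o
  | reidemeister₁ i b o => exact LocalMove.reidemeister₁ (i + k) b o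
  | reidemeister₁' i o => exact LocalMove.reidemeister₁' (i + k) o
  | reidemeister₂ i o => exact LocalMove.reidemeister₂ (i + k) o
  | reidemeister₃ i a b c h =>
    simpa [Nat.add_right_comm i 1 k] using LocalMove.reidemeister₃ (i + k) a b c h

/-- The word `w` is a tangle from the strands `s` to the strands `t`. -/
def Runs (w : List Slice) (s t : List Bool) : Prop := runSlices w s = some t

namespace Runs

theorem nil (s : List Bool) : Runs [] s s := rfl

theorem append {u v : List Slice} {s t r : List Bool} (hu : Runs u s t) (hv : Runs v t r) :
    Runs (u ++ v) s r := by
  unfold Runs at *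
  rw [BTree.runSlices_append, hu, Option.bind_some, hv]

theorem cons_iff {e : Slice} {w : List Slice} {s r : List Bool} :
    Runs (e :: w) s r ↔ ∃ t, e.apply s = some t ∧ Runs w t r := by
  simp [Runs, runSlices, Option.bind_eq_some_iff]

theorem append_iff {u v : List Slice} {s r : List Bool} :
    Runs (u ++ v) s r ↔ ∃ t, Runs u s t ∧ Runs v t r := by
  simp [Runs, BTree.runSlices_append, Option.bind_eq_some_iff]

theorem unique {w : List Slice} {s t t' : List Bool} (h : Runs w s t) (h' : Runs w s t') :
    t = t' := Option.some.inj (h.symm.trans h')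

/-- Idle strands on either side do not affect a tangle. This makes it possible to prove each isotopy
on the few strands that take part. -/
theorem frame {w : List Slice} {s t : List Bool} (h : Runs w s t) (l r : List Bool) :
    Runs (shift l.length w) (l ++ s ++ r) (l ++ t ++ r) := by
  induction w generalizing s with
  | nil => cases h; exact nil _
  | cons e w ih =>
    obtain ⟨i, e⟩ := e
    obtain ⟨t', ht', hw⟩ := cons_iff.mp h
    refine cons_iff.mpr ⟨_, ?_, ih hw⟩
    obtain ⟨a, m, m', b, rfl, rfl, rfl, hm⟩ := Slice.apply_eq_some_iff.mp ht'
    exact Slice.apply_eq_some_iff.mpr ⟨l ++ a, m, m', b ++ r, by simp [Nat.add_comm], by simp,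
      by simp, hm⟩

theorem frame_right {w : List Slice} {s t : List Bool} (h : Runs w s t) (r : List Bool) :
    Runs w (s ++ r) (t ++ r) := by
  simpa using h.frame [] r

end Runs

theorem signsOfSlices_append {u : List Slice} {s t : List Bool} (h : Runs u s t)
    (v : List Slice) : signsOfSlices (u ++ v) s = signsOfSlices u s ++ signsOfSlices v t := by
  induction u generalizing s with
  | nil => cases h; rfl
  | cons e u ih =>
    obtain ⟨t', ht', hu⟩ := Runs.cons_iff.mp h
    simp [signsOfSlices, ht', ih hu]

theorem signsOfSlices_frame {w : List Slice} {s t : List Bool} (h : Runs w s t)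
    (l r : List Bool) :
    signsOfSlices (shift l.length w) (l ++ s ++ r) = signsOfSlices w s := by
  induction w generalizing s with
  | nil => rfl
  | cons e w ih =>
    obtain ⟨i, e⟩ := e
    obtain ⟨t', ht', hw⟩ := Runs.cons_iff.mp h
    have h1 : Slice.apply (l ++ s ++ r) ⟨i + l.length, e⟩ = some (l ++ t' ++ r) := by
      have := Runs.frame (w := [⟨i, e⟩]) (s := s) (t := t')
        (Runs.cons_iff.mpr ⟨t', ht', Runs.nil _⟩) l r
      obtain ⟨t'', h2, h3⟩ := Runs.cons_iff.mp this
      rw [h2, h3.unique (Runs.nil _)]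
    simp only [shift_cons, signsOfSlices, h1, ht', Option.elim_some, ih hw]
    congr 1
    obtain ⟨a, m, m', b, rfl, rfl, rfl, hm⟩ := Slice.apply_eq_some_iff.mp ht'
    rw [Slice.signs_append a m b e hm.length.1]
    have := Slice.signs_append (l ++ a) m (b ++ r) e hm.length.1
    simpa [Nat.add_comm] using this

/-! ### Isotopy of tangles -/

/-- One local move between two tangles from `s` to `t`. -/
def TangleMove (s t : List Bool) (u v : List Slice) : Prop :=
  Runs u s t ∧ Runs v s t ∧
    ∃ a b l r : List Slice, LocalMove l r ∧ u = a ++ l ++ b ∧ v = a ++ r ++ b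

/-- The words `u` and `v` describe isotopic tangles from the strands `s` to the strands `t`. -/
def Isotopic (s t : List Bool) (u v : List Slice) : Prop :=
  Runs u s t ∧ Runs v s t ∧ Relation.EqvGen (TangleMove s t) u v

namespace Isotopic

variable {s t r : List Bool} {u v w u' v' : List Slice}

theorem refl (h : Runs u s t) : Isotopic s t u u := ⟨h, h, .refl _⟩

theorem symm (h : Isotopic s t u v) : Isotopic s t v u := ⟨h.2.1, h.1, .symm _ _ h.2.2⟩

theorem trans (h : Isotopic s t u v) (h' : Isotopic s t v w) : Isotopic s t u w :=
  ⟨h.1, h'.2.1, .trans _ _ _ h.2.2 h'.2.2⟩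

theorem of_eq (h : Runs u s t) (e : u = v) : Isotopic s t u v := e ▸ refl h

theorem of_move (hu : Runs u s t) (hv : Runs v s t) (h : LocalMove u v) : Isotopic s t u v :=
  ⟨hu, hv, .rel _ _ ⟨hu, hv, [], [], u, v, h, by simp, by simp⟩⟩

theorem frame (h : Isotopic s t u v) (l r : List Bool) :
    Isotopic (l ++ s ++ r) (l ++ t ++ r) (shift l.length u) (shift l.length v) := by
  refine ⟨h.1.frame l r, h.2.1.frame l r, ?_⟩
  have h' := h.2.2
  clear h
  induction h' with
  | rel u v h =>
    obtain ⟨hu, hv, a, b, x, y, hm, rfl, rfl⟩ := h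
    exact .rel _ _ ⟨hu.frame l r, hv.frame l r, shift l.length a, shift l.length b,
      shift l.length x, shift l.length y, hm.shift _, by simp, by simp⟩
  | refl => exact .refl _
  | symm _ _ _ ih => exact .symm _ _ ih
  | trans _ _ _ _ _ ih ih' => exact .trans _ _ _ ih ih'

theorem frame_right (h : Isotopic s t u v) (r : List Bool) :
    Isotopic (s ++ r) (t ++ r) u v := by
  simpa using h.frame [] r

theorem frame_left (h : Isotopic s t u v) (l : List Bool) :
    Isotopic (l ++ s) (l ++ t) (shift l.length u) (shift l.length v) := by
  simpa using h.frame l []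

theorem append_left (hw : Runs w s r) (h : Isotopic r t u v) :
    Isotopic s t (w ++ u) (w ++ v) := by
  refine ⟨hw.append h.1, hw.append h.2.1, ?_⟩
  have h' := h.2.2
  clear h
  induction h' with
  | rel u v h =>
    obtain ⟨hu, hv, a, b, x, y, hm, rfl, rfl⟩ := h
    exact .rel _ _ ⟨hw.append hu, hw.append hv, w ++ a, b, x, y, hm, by simp, by simp⟩
  | refl => exact .refl _
  | symm _ _ _ ih => exact .symm _ _ ih
  | trans _ _ _ _ _ ih ih' => exact .trans _ _ _ ih ih'

theorem append_right (h : Isotopic s r u v) (hw : Runs w r t) :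
    Isotopic s t (u ++ w) (v ++ w) := by
  refine ⟨h.1.append hw, h.2.1.append hw, ?_⟩
  have h' := h.2.2
  clear h
  induction h' with
  | rel u v h =>
    obtain ⟨hu, hv, a, b, x, y, hm, rfl, rfl⟩ := h
    exact .rel _ _ ⟨hu.append hw, hv.append hw, a, b ++ w, x, y, hm, by simp, by simp⟩
  | refl => exact .refl _
  | symm _ _ _ ih => exact .symm _ _ ih
  | trans _ _ _ _ _ ih ih' => exact .trans _ _ _ ih ih'

theorem append (h : Isotopic s r u v) (h' : Isotopic r t u' v') :
    Isotopic s t (u ++ u') (v ++ v') :=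
  (h.append_right h'.1).trans (append_left h.2.1 h')

end Isotopic

theorem Isotopic.of_move_within {s t : List Bool} {u v l r : List Slice} (hu : Runs u s t)
    (hv : Runs v s t) (a b : List Slice) (h : LocalMove l r) (eu : u = a ++ l ++ b)
    (ev : v = a ++ r ++ b) : Isotopic s t u v :=
  ⟨hu, hv, .rel _ _ ⟨hu, hv, a, b, l, r, h, eu, ev⟩⟩

theorem LinkDiagram.sameLink_of_isotopic {D E : LinkDiagram}
    (h : Isotopic [] [] D.word E.word) : D.SameLink E := by
  -- The chain of moves may a priori pass through words that are not closed diagrams. The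
  -- equivalence of `Runs` is carried along so that the intermediate word in the transitive case is
  -- a `LinkDiagram`.
  have key : ∀ u v, Relation.EqvGen (TangleMove [] []) u v →
      (Runs u [] [] ↔ Runs v [] []) ∧ ∀ (hu : Runs u [] []) (hv : Runs v [] []),
        LinkDiagram.SameLink ⟨u, hu⟩ ⟨v, hv⟩ := by
    intro u v h
    induction h with
    | rel u v h =>
      obtain ⟨hu, hv, a, b, x, y, hm, e, e'⟩ := h
      exact ⟨⟨fun _ => hv, fun _ => hu⟩, fun _ _ => .rel _ _ ⟨a, b, x, y, hm, e, e'⟩⟩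
    | refl u => exact ⟨Iff.rfl, fun _ _ => .refl _⟩
    | symm u v _ ih => exact ⟨ih.1.symm, fun hv hu => .symm _ _ (ih.2 hu hv)⟩
    | trans u v w _ _ ih ih' =>
      refine ⟨ih.1.trans ih'.1, fun hu hw => ?_⟩
      have hv := ih.1.mp hu
      exact .trans _ _ _ (ih.2 hu hv) (ih'.2 hv hw)
  exact (key _ _ h.2.2).2 h.1 h.2.1

/-! ### Interchanging distant tangles -/

theorem Runs.singleton {e : Slice} {s t : List Bool} (h : e.apply s = some t) :
    Runs [e] s t := Runs.cons_iff.mpr ⟨t, h, Runs.nil _⟩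

theorem isotopic_interchange_slices {e f : Slice} {s t s' t' : List Bool}
    (he : e.apply s = some t) (hf : f.apply s' = some t') :
    Isotopic (s ++ s') (t ++ t') ([e] ++ shift t.length [f]) (shift s.length [f] ++ [e]) := by
  refine .of_move ?_ ?_ ?_
  · refine ((Runs.singleton he).frame_right s').append ?_
    simpa using (Runs.singleton hf).frame t []
  · refine Runs.append ?_ ((Runs.singleton he).frame_right t')
    simpa using (Runs.singleton hf).frame s []
  · obtain ⟨i, e⟩ := e
    obtain ⟨k, f⟩ := f
    obtain ⟨a, m, m', b, rfl, rfl, rfl, hm⟩ := Slice.apply_eq_some_iff.mp he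
    -- The gap between the events consists of the `b.length` idle strands right of `e` within the
    -- first tangle and the `k` strands left of `f` within the second.
    have h := LocalMove.far a.length (b.length + k) e f
    rw [← hm.length.1, ← hm.length.2] at h
    simp only [List.length_append, shift_cons, shift_nil, List.cons_append, List.nil_append]
    rwa [show k + (a.length + m'.length + b.length) = a.length + m'.length + (b.length + k) by
      omega, show k + (a.length + m.length + b.length) = a.length + m.length + (b.length + k) by
      omega]

theorem isotopic_interchange_slice {e : Slice} {v : List Slice} {s t s' t' : List Bool}
    (he : e.apply s = some t) (hv : Runs v s' t') :
    Isotopic (s ++ s') (t ++ t') ([e] ++ shift t.length v) (shift s.length v ++ [e]) := by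
  induction v generalizing s' with
  | nil =>
    cases hv
    exact .refl (by simpa using (Runs.singleton he).frame_right _)
  | cons f v ih =>
    obtain ⟨r, hf, hv⟩ := Runs.cons_iff.mp hv
    have h1 := (isotopic_interchange_slices he hf).append_right
      (w := shift t.length v) (t := t ++ t') (by simpa using hv.frame t [])
    have h2 := Isotopic.append_left (w := shift s.length [f]) (s := s ++ s')
      (by simpa using (Runs.singleton hf).frame s []) (ih hv)
    simp only [List.append_assoc] at h1 h2
    have h := h1.trans h2
    rw [← shift_append, ← List.append_assoc, ← shift_append] at h
    exact h

/-- Two tangles side by side are interchanged. -/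
theorem isotopic_interchange {u v : List Slice} {s t s' t' : List Bool}
    (hu : Runs u s t) (hv : Runs v s' t') :
    Isotopic (s ++ s') (t ++ t') (u ++ shift t.length v) (shift s.length v ++ u) := by
  induction u generalizing s with
  | nil =>
    cases hu
    exact .of_eq (by simpa using hv.frame t []) (by simp)
  | cons e u ih =>
    obtain ⟨r, he, hu⟩ := Runs.cons_iff.mp hu
    have h1 := Isotopic.append_left ((Runs.singleton he).frame_right s') (ih hu)
    have h2 := (isotopic_interchange_slice he hv).append_right (hu.frame_right t')
    simp only [List.append_assoc] at h1 h2
    exact h1.trans h2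

/-! ### A strand that passes over a tangle -/

/-- The leftmost strand passes over the next `n` strands. -/
def overpass : ℕ → List Slice
  | 0 => []
  | n + 1 => ⟨0, .cross true⟩ :: shift 1 (overpass n)

theorem overpass_add (m n : ℕ) : overpass (m + n) = overpass m ++ shift m (overpass n) := by
  induction m with
  | zero => simp [overpass]
  | succ m ih => rw [Nat.add_right_comm]; simp [overpass, ih, shift_shift]

theorem runs_overpass (y : Bool) (s : List Bool) :
    Runs (overpass s.length) (y :: s) (s ++ [y]) := by
  induction s with
  | nil => exact Runs.nil _
  | cons a s ih =>
    refine Runs.cons_iff.mpr ⟨a :: y :: s, by simp [Slice.apply], ?_⟩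
    simpa using ih.frame [a] []

/-- For a maximum or minimum, the strand is slid to the other leg, where it undoes a crossing by the
second Reidemeister move. For a crossing this is the third Reidemeister move, which is acyclic for
either value of `o` because the moving strand is above both others. -/
theorem isotopic_overpass_event (y : Bool) {e : LinkEvent} {m m' : List Bool}
    (h : e.Acts m m') : Isotopic (y :: m) (m' ++ [y])
      (overpass m.length ++ [⟨0, e⟩]) (⟨1, e⟩ :: overpass m'.length) := by
  cases h with
  | birth b =>
    have h1 : Isotopic [y] [b, y, !b] [⟨1, .birth b⟩, ⟨0, .cross true⟩]
        [⟨0, .birth b⟩, ⟨1, .cross false⟩] :=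
      .symm (.of_move rfl rfl (.slideMax 0 b false))
    have h2 : Isotopic [b, !b, y] [b, !b, y] [⟨1, .cross false⟩, ⟨1, .cross true⟩] [] :=
      .of_move rfl rfl (.reidemeister₂ 1 false)
    exact ((h1.append_right (w := [⟨1, .cross true⟩]) (t := [b, !b, y]) rfl).trans
      (Isotopic.append_left (w := [⟨0, .birth b⟩]) (s := [y]) rfl h2)).symm
  | death a =>
    have hd : Runs [⟨1, .death⟩] [y, a, !a] [y] := by
      simp [Runs, runSlices, Slice.apply]
    have h1 : Isotopic [a, y, !a] [y] [⟨1, .cross true⟩, ⟨0, .death⟩]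
        [⟨0, .cross false⟩, ⟨1, .death⟩] :=
      .of_move (by simp [Runs, runSlices, Slice.apply]) (by simp [Runs, runSlices, Slice.apply])
        (.slideMin 0 true)
    have h2 : Isotopic [y, a, !a] [y, a, !a] [⟨0, .cross true⟩, ⟨0, .cross false⟩] [] :=
      .of_move rfl rfl (.reidemeister₂ 0 true)
    exact (Isotopic.append_left (w := [⟨0, .cross true⟩]) (s := [y, a, !a]) rfl h1).trans
      (h2.append_right (w := [⟨1, .death⟩]) hd)
  | cross o a b =>
    exact .of_move rfl rfl (.reidemeister₃ 0 true true o (fun _ => rfl))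

/-- The overpass is cut into three pieces: over the strands left of the event, over its own strands,
and over those to the right. The event is commuted with the outer two by interchange and with the
middle one by `isotopic_overpass_event`. -/
theorem isotopic_overpass_slice (y : Bool) {i : ℕ} {e : LinkEvent} {s t : List Bool}
    (h : Slice.apply s ⟨i, e⟩ = some t) : Isotopic (y :: s) (t ++ [y])
      (overpass s.length ++ [⟨i, e⟩]) (⟨i + 1, e⟩ :: overpass t.length) := by
  obtain ⟨l, m, m', r, rfl, rfl, rfl, hm⟩ := Slice.apply_eq_some_iff.mp h
  have hev : Runs [⟨0, e⟩] m m' := Runs.singleton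
    (Slice.apply_eq_some_iff.mpr ⟨[], m, m', [], rfl, by simp, by simp, hm⟩)
  have e1 : overpass (l ++ m ++ r).length = overpass l.length ++
      (shift l.length (overpass m.length) ++ shift (l ++ m).length (overpass r.length)) := by
    rw [List.length_append, overpass_add, List.length_append, overpass_add, List.append_assoc]
  have e2 : overpass (l ++ m' ++ r).length = overpass l.length ++
      (shift l.length (overpass m'.length) ++ shift (l ++ m').length (overpass r.length)) := by
    rw [List.length_append, overpass_add, List.length_append, overpass_add, List.append_assoc]
  have hl : Runs (overpass l.length) (y :: (l ++ m ++ r)) (l ++ (y :: m) ++ r) := by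
    simpa using (runs_overpass y l).frame_right (m ++ r)
  have hm1 : Runs (shift l.length (overpass m.length)) (l ++ (y :: m) ++ r)
      (l ++ (m ++ [y]) ++ r) := (runs_overpass y m).frame l r
  have hr' : Runs (shift (l ++ m').length (overpass r.length)) (l ++ (m' ++ [y]) ++ r)
      (l ++ m' ++ r ++ [y]) := by
    simpa using (runs_overpass y r).frame (l ++ m') []
  -- the event passes the strands on its right
  have s1 : Isotopic (l ++ (m ++ [y]) ++ r) (l ++ m' ++ r ++ [y])
      (shift (l ++ m).length (overpass r.length) ++ [⟨l.length, e⟩])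
      ([⟨l.length, e⟩] ++ shift (l ++ m').length (overpass r.length)) := by
    have := (isotopic_interchange hev (runs_overpass y r)).symm.frame_left l
    simpa [shift_shift, Nat.add_comm] using this
  have s2 : Isotopic (l ++ (y :: m) ++ r) (l ++ (m' ++ [y]) ++ r)
      (shift l.length (overpass m.length) ++ [⟨l.length, e⟩])
      ([⟨l.length + 1, e⟩] ++ shift l.length (overpass m'.length)) := by
    have := (isotopic_overpass_event y hm).frame l r
    simpa [Nat.add_comm] using this
  have s3 : Isotopic (y :: (l ++ m ++ r)) (l ++ (y :: m') ++ r)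
      (overpass l.length ++ [⟨l.length + 1, e⟩]) ([⟨l.length + 1, e⟩] ++ overpass l.length) := by
    have := isotopic_interchange (runs_overpass y l) (hev.frame_right r)
    simpa [Nat.add_comm] using this
  have hx := Isotopic.append_left hl (Isotopic.append_left hm1 s1)
  have hy := Isotopic.append_left hl (s2.append_right hr')
  have hz := s3.append_right (((runs_overpass y m').frame l r).append hr')
  rw [e1, e2]
  simp only [List.append_assoc] at hx hy hz ⊢
  exact hx.trans (hy.trans hz)

/-- A strand that passes over a tangle may do so above or below the tangle. -/
theorem isotopic_overpass (y : Bool) {w : List Slice} {s t : List Bool} (h : Runs w s t) :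
    Isotopic (y :: s) (t ++ [y]) (overpass s.length ++ w) (shift 1 w ++ overpass t.length) := by
  induction w generalizing s with
  | nil => cases h; exact .of_eq (by simpa using runs_overpass y t) (by simp)
  | cons e w ih =>
    obtain ⟨i, e⟩ := e
    obtain ⟨r, he, hw⟩ := Runs.cons_iff.mp h
    have h1 := (isotopic_overpass_slice y he).append_right (hw.frame_right [y])
    have h2 := Isotopic.append_left (w := [⟨i + 1, e⟩]) (s := y :: s)
      (by simpa using (Runs.singleton he).frame [y] []) (ih hw)
    simp only [List.append_assoc] at h1 h2
    exact h1.trans h2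
/-! ### Positive tangles -/

/-- The tangle `w` from `s` to `t` is isotopic to one with at most `n` crossings, all of which are
positive. -/
def HasPositiveForm (s t : List Bool) (w : List Slice) (n : ℕ) : Prop :=
  ∃ w', Isotopic s t w w' ∧ (∀ ε ∈ signsOfSlices w' s, ε = 1) ∧ (signsOfSlices w' s).length ≤ n

namespace HasPositiveForm

variable {s t r : List Bool} {u v w : List Slice} {m n : ℕ}

theorem runs (h : HasPositiveForm s t w n) : Runs w s t := by
  obtain ⟨w', h, -⟩ := h
  exact h.1

theorem of_isotopic (h : HasPositiveForm s t v n) (e : Isotopic s t u v) :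
    HasPositiveForm s t u n := by
  obtain ⟨w', h, h'⟩ := h
  exact ⟨w', e.trans h, h'⟩

theorem mono (h : HasPositiveForm s t w m) (hmn : m ≤ n) : HasPositiveForm s t w n := by
  obtain ⟨w', h, h', h''⟩ := h
  exact ⟨w', h, h', h''.trans hmn⟩

theorem of_signs (h : Runs w s t) (h' : signsOfSlices w s = List.replicate n 1) :
    HasPositiveForm s t w n :=
  ⟨w, .refl h, by rw [h']; exact fun _ => List.eq_of_mem_replicate, by rw [h']; simp⟩

theorem append (hu : HasPositiveForm s r u m) (hv : HasPositiveForm r t v n) :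
    HasPositiveForm s t (u ++ v) (m + n) := by
  obtain ⟨u', hu, hu', hu''⟩ := hu
  obtain ⟨v', hv, hv', hv''⟩ := hv
  have e := signsOfSlices_append hu.2.1 v'
  refine ⟨u' ++ v', hu.append hv, ?_, ?_⟩
  · rw [e]
    intro ε h
    exact (List.mem_append.mp h).elim (hu' ε) (hv' ε)
  · rw [e, List.length_append]
    omega

theorem frame (h : HasPositiveForm s t w n) (l r : List Bool) :
    HasPositiveForm (l ++ s ++ r) (l ++ t ++ r) (shift l.length w) n := by
  obtain ⟨w', h, h', h''⟩ := h
  refine ⟨_, h.frame l r, ?_, ?_⟩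
  · rwa [signsOfSlices_frame h.2.1]
  · rwa [signsOfSlices_frame h.2.1]

end HasPositiveForm

/-! ### The carets of the two trees -/

/-- The diagram of a caret of the top tree. -/
def topCaret (x : Bool) : List Slice := [⟨0, .birth x⟩, ⟨1, .cross true⟩]

/-- The diagram of a caret of the bottom tree. -/
def botCaret : List Slice := [⟨1, .cross false⟩, ⟨0, .death⟩]

theorem runs_topCaret (x a : Bool) (s : List Bool) :
    Runs (topCaret x) (a :: s) (x :: a :: (!x) :: s) := by
  simp [topCaret, Runs, runSlices, Slice.apply]

theorem runs_botCaret (x a : Bool) (s : List Bool) :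
    Runs botCaret (x :: a :: (!x) :: s) (a :: s) := by
  simp [botCaret, Runs, runSlices, Slice.apply]

theorem runs_botCaret' (x a : Bool) (s : List Bool) :
    Runs botCaret ((!x) :: a :: x :: s) (a :: s) := by
  simpa using runs_botCaret (!x) a s

/-- The arc formed by two opposing carets is pulled off the strand between its legs. -/
theorem isotopic_slide_arc (x a : Bool) {s t : List Bool} {w : List Slice}
    (h : Runs w ((!x) :: s) ((!x) :: t)) :
    Isotopic (a :: s) (a :: t) (topCaret x ++ shift 2 w ++ botCaret)
      ([⟨1, .birth x⟩] ++ shift 2 w ++ [⟨1, .death⟩]) := by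
  have hb : Runs [⟨1, .birth x⟩] (a :: s) (a :: x :: (!x) :: s) := by
    simp [Runs, runSlices, Slice.apply]
  have hd : Runs [⟨1, .death⟩] (a :: x :: (!x) :: t) (a :: t) := by
    simp [Runs, runSlices, Slice.apply]
  have hc : ∀ o, Runs [⟨0, .cross o⟩] [a, x] [x, a] := fun o => rfl
  have hf : Runs [⟨0, .cross true⟩] (x :: a :: (!x) :: t) (a :: x :: (!x) :: t) := by
    simp [Runs, runSlices, Slice.apply]
  have hw : Runs (shift 2 w) (a :: x :: (!x) :: s) (a :: x :: (!x) :: t) := by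
    simpa using h.frame [a, x] []
  have hw' : Runs (shift 2 w) (x :: a :: (!x) :: s) (x :: a :: (!x) :: t) := by
    simpa using h.frame [x, a] []
  have h1 : Isotopic (a :: s) (x :: a :: (!x) :: s) (topCaret x)
      ([⟨1, .birth x⟩] ++ [⟨0, .cross false⟩]) :=
    .of_move (runs_topCaret x a s) (hb.append ((hc _).frame_right ((!x) :: s)))
      (.slideMax 0 x true)
  have h2 : Isotopic (x :: a :: (!x) :: t) (a :: t) botCaret
      ([⟨0, .cross true⟩] ++ [⟨1, .death⟩]) :=
    .of_move (runs_botCaret x a t) (Runs.append hf hd)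
      (.slideMin 0 false)
  have h3 : Isotopic (a :: x :: (!x) :: s) (x :: a :: (!x) :: t)
      ([⟨0, .cross false⟩] ++ shift 2 w) (shift 2 w ++ [⟨0, .cross false⟩]) := by
    simpa using isotopic_interchange (hc false) h
  have h4 : Isotopic (a :: x :: (!x) :: t) (a :: x :: (!x) :: t)
      ([⟨0, .cross false⟩] ++ [⟨0, .cross true⟩]) [] :=
    .of_move rfl rfl (.reidemeister₂ 0 false)
  have e1 := h1.append ((Isotopic.refl hw').append h2)
  have e2 := (Isotopic.refl hb).append (h3.append
    (Isotopic.refl (Runs.append hf hd)))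
  have e3 := (Isotopic.refl hb).append ((Isotopic.refl hw).append
    (h4.append (Isotopic.refl hd)))
  simp only [List.append_assoc, List.nil_append] at e1 e2 e3 ⊢
  exact e1.trans (e2.trans e3)

/-- Once the arc has slid off its root strand, it still passes over one strand. Sliding that
crossing from leg to leg straightens the arc to a zigzag and leaves a curl, which the first
Reidemeister move removes. -/
theorem isotopic_kink (y : Bool) : Isotopic [y, !y, y] [y]
    (topCaret y ++ shift 2 botCaret ++ botCaret) [⟨1, .death⟩] := by
  refine (isotopic_slide_arc y y (t := []) (by simpa using runs_botCaret' y (!y) [])).trans ?_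
  refine .trans (.of_move_within (v := [⟨1, .birth y⟩, ⟨2, .cross true⟩, ⟨3, .death⟩, ⟨1, .death⟩])
    ?_ ?_ [⟨1, .birth y⟩] [⟨1, .death⟩] (.slideMin 2 false) rfl rfl) ?_
  · cases y <;> rfl
  · cases y <;> rfl
  refine .trans (.of_move_within (v := [⟨2, .birth y⟩, ⟨1, .cross false⟩, ⟨3, .death⟩, ⟨1, .death⟩])
    ?_ ?_ [] [⟨3, .death⟩, ⟨1, .death⟩] (.slideMax 1 y true) rfl rfl) ?_
  · cases y <;> rfl
  · cases y <;> rfl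
  refine .trans (.of_move_within (v := [⟨2, .birth y⟩, ⟨3, .death⟩, ⟨1, .cross false⟩, ⟨1, .death⟩])
    ?_ ?_ [⟨2, .birth y⟩] [⟨1, .death⟩] (.far 1 0 (.cross false) .death) rfl rfl) ?_
  · cases y <;> rfl
  · cases y <;> rfl
  refine .trans (.of_move_within (v := [⟨1, .cross false⟩, ⟨1, .death⟩])
    ?_ ?_ [] [⟨1, .cross false⟩, ⟨1, .death⟩] (.zigzag 2 y) rfl rfl) ?_
  · cases y <;> rfl
  · cases y <;> rfl
  refine .of_move ?_ ?_ (.reidemeister₁' 1 false)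
  · cases y <;> rfl
  · cases y <;> rfl

/-- A strand that passes over a tangle from the right and enters it from the left is moved to the
other side of the tangle. -/
theorem isotopic_turn (y : Bool) {w : List Slice} (h : Runs w [y, y, !y] [y]) :
    Isotopic [y, !y, y] [y] (topCaret y ++ shift 2 botCaret ++ w)
      ([⟨0, .birth !y⟩] ++ shift 1 w ++ [⟨0, .cross true⟩, ⟨1, .death⟩]) := by
  -- The caret over the vine caret is one strand that comes in on the right, passes over the other
  -- two and turns into the leftmost entry of `w`.
  have hX : Isotopic [y, !y, y] [y, y, !y] (topCaret y ++ shift 2 botCaret)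
      [⟨0, .birth y⟩, ⟨1, .cross true⟩, ⟨2, .cross true⟩, ⟨3, .death⟩] := by
    refine .of_move_within ?_ ?_ (topCaret y) [] (.slideMin 2 false) rfl rfl
    · cases y <;> rfl
    · cases y <;> rfl
  -- The additional curl makes the strand pass over its own continuation as well, so that it crosses
  -- all three strands entering `w` and forms a full overpass.
  have hK : Isotopic [y, !y, y] [y, y, !y]
      [⟨0, .birth !y⟩, ⟨0, .cross true⟩, ⟨1, .cross true⟩, ⟨2, .cross true⟩, ⟨3, .death⟩]
      [⟨0, .birth y⟩, ⟨1, .cross true⟩, ⟨2, .cross true⟩, ⟨3, .death⟩] := by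
    have hm := LocalMove.reidemeister₁ 0 (!y) true
    rw [Bool.not_not] at hm
    refine .of_move_within ?_ ?_ [] [⟨1, .cross true⟩, ⟨2, .cross true⟩, ⟨3, .death⟩] hm rfl rfl
    · cases y <;> rfl
    · cases y <;> rfl
  have hI : Isotopic [y, y, !y, !y, y] [y] (w ++ [⟨1, .death⟩]) ([⟨3, .death⟩] ++ w) :=
    isotopic_interchange (v := [⟨0, .death⟩]) (s' := [!y, y]) (t' := []) h (by cases y <;> rfl)
  -- Only one strand leaves `w`, so the three crossings above `w` become a single crossing below it.
  have hO : Isotopic [!y, y, y, !y, y] [y, !y, y]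
      ([⟨0, .cross true⟩, ⟨1, .cross true⟩, ⟨2, .cross true⟩] ++ w)
      (shift 1 w ++ [⟨0, .cross true⟩]) :=
    (isotopic_overpass (!y) h).frame_right [y]
  have e1 := (hX.trans hK.symm).append_right h
  have e2 := Isotopic.append_left (s := [y, !y, y])
    (w := [⟨0, .birth !y⟩, ⟨0, .cross true⟩, ⟨1, .cross true⟩, ⟨2, .cross true⟩])
    (by cases y <;> rfl) hI.symm
  have e3 := Isotopic.append_left (s := [y, !y, y]) (w := [⟨0, .birth !y⟩])
    (by cases y <;> rfl) (hO.append_right (w := [⟨1, .death⟩]) (t := [y]) (by cases y <;> rfl))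
  simp only [List.append_assoc, List.cons_append, List.nil_append] at e1 e2 e3 ⊢
  exact e1.trans (e2.trans e3)

namespace HasPositiveForm

variable {s : List Bool} {w v : List Slice} {m n : ℕ}

/-- The crossings of the two opposing carets have opposite signs, and both disappear when the arc is
pulled off. -/
theorem slide_arc (x a : Bool) (h : HasPositiveForm ((!x) :: s) [!x] w m) :
    HasPositiveForm (a :: s) [a] (topCaret x ++ shift 2 w ++ botCaret) m := by
  have hb : HasPositiveForm (a :: s) (a :: x :: (!x) :: s) [⟨1, .birth x⟩] 0 :=
    of_signs (by simp [Runs, runSlices, Slice.apply]) (by simp [signsOfSlices, Slice.signs,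
      Slice.apply])
  have hd : HasPositiveForm [a, x, !x] [a] [⟨1, .death⟩] 0 := by
    cases x <;> exact of_signs rfl rfl
  have hw : HasPositiveForm (a :: x :: (!x) :: s) [a, x, !x] (shift 2 w) m := by
    simpa using h.frame [a, x] []
  have := (hb.append hw).append hd
  rw [zero_add, add_zero] at this
  exact this.of_isotopic (isotopic_slide_arc x a h.runs)

/-- The strand from the root has the orientation `x` of the left leg, hence is opposite to the right
leg that crosses over it; this makes the crossing positive. -/
theorem topCaret (x : Bool) (s : List Bool) :
    HasPositiveForm (x :: s) (x :: x :: (!x) :: s) (topCaret x) 1 :=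
  of_signs (runs_topCaret x x s) (by simp [_root_.topCaret, signsOfSlices, Slice.signs,
    Slice.apply])

theorem caret (x : Bool) (h : HasPositiveForm ((!x) :: s) [!x] w m)
    (h' : HasPositiveForm [x, x, !x] [x] v n) :
    HasPositiveForm (x :: s) [x] (_root_.topCaret x ++ shift 2 w ++ v) (m + (n + 1)) := by
  have hw : HasPositiveForm (x :: x :: (!x) :: s) [x, x, !x] (shift 2 w) m := by
    simpa using h.frame [x, x] []
  exact (((topCaret x s).append hw).append h').mono (by omega)

theorem kink (y : Bool) : HasPositiveForm [y, !y, y] [y]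
    (_root_.topCaret y ++ shift 2 botCaret ++ botCaret) 0 := by
  refine of_isotopic ?_ (isotopic_kink y)
  cases y <;> exact of_signs rfl rfl

theorem turn (y : Bool) (h : HasPositiveForm [y, y, !y] [y] w n) :
    HasPositiveForm [y, !y, y] [y] (_root_.topCaret y ++ shift 2 botCaret ++ w) (n + 1) := by
  refine of_isotopic ?_ (isotopic_turn y h.runs)
  have hb : HasPositiveForm [y, !y, y] [!y, y, y, !y, y] [⟨0, .birth !y⟩] 0 := by
    cases y <;> exact of_signs rfl rfl
  have hd : HasPositiveForm [!y, y, y] [y] [⟨0, .cross true⟩, ⟨1, .death⟩] 1 := by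
    cases y <;> exact of_signs rfl rfl
  exact ((hb.append (h.frame [!y] [y])).append hd).mono (by omega)

end HasPositiveForm

/-! ### Trees over a right vine -/

namespace BTree

/-- The tangle formed by the upper half of the diagram of a tree and by as many carets of the right
vine below it as it has leaves, in which the carets of both halves are nested. -/
def vineTangle : Bool → BTree → List Slice
  | _, leaf => botCaret
  | x, node l r => topCaret x ++ shift 2 (vineTangle (!x) r) ++ vineTangle x l

/-- The tangle formed by the upper half of the diagram of a tree and by the right vine with the
same number of leaves. -/
def vineClosure : Bool → BTree → List Slice
  | _, leaf => []
  | x, node l r => topCaret x ++ shift 2 (vineClosure (!x) r) ++ vineTangle x l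

end BTree

/-! ### Counting crossings by right leaves -/

namespace TTree

theorem rightLeaves_node (a b c : TTree) : (c = leaf ∧ (node a b c).rightLeaves =
    a.rightLeaves + b.rightLeaves + 1) ∨ (c ≠ leaf ∧ (node a b c).rightLeaves =
    a.rightLeaves + b.rightLeaves + c.rightLeaves) := by
  cases c with
  | leaf => exact .inl ⟨rfl, rfl⟩
  | node c d e => exact .inr ⟨by simp, rfl⟩

/-- If `A` is a leaf, the arc slides off and nothing is added. Otherwise the caret costs one
positive crossing, exactly the one that the tangle of `A` saves. The bound for `A` is a hypothesis
so that an induction hypothesis can be supplied. -/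
theorem hasPositiveForm_caret_of {A : TTree} (hA : A ≠ leaf → ∃ n, n + 1 = A.rightLeaves ∧
    ∀ x, HasPositiveForm [x, x, !x] [x] (A.binary.vineTangle x) n) (x : Bool) {s : List Bool}
    {w : List Slice} {m : ℕ} (hw : HasPositiveForm ((!x) :: s) [!x] w m) :
    HasPositiveForm (x :: s) [x]
      (topCaret x ++ shift 2 w ++ A.binary.vineTangle x) (m + A.rightLeaves) := by
  by_cases h : A = leaf
  · subst h
    exact hw.slide_arc x x
  · obtain ⟨n, hn, hA⟩ := hA h
    rw [← hn]
    exact hw.caret x (hA x)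

/-- The saving of one crossing is inherited from the right child if that is not a leaf. If it is a
leaf, it counts as a right leaf but costs nothing beyond the right leaves of the middle child, by
`kink` or `turn`. -/
theorem hasPositiveForm_vineTangle (U : TTree) (hU : U ≠ leaf) : ∃ n, n + 1 = U.rightLeaves ∧
    ∀ x, HasPositiveForm [x, x, !x] [x] (U.binary.vineTangle x) n := by
  induction U with
  | leaf => exact absurd rfl hU
  | node a b c iha ihb ihc =>
    -- This treats the second caret of the vertex, which carries `b` and `c`. The first caret then
    -- adds the right leaves of `a`.
    have hM : ∃ m, m + a.rightLeaves + 1 = (node a b c).rightLeaves ∧ ∀ y,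
        HasPositiveForm [y, !y, y] [y] (topCaret y ++ shift 2 (c.binary.vineTangle (!y)) ++
          b.binary.vineTangle y) m := by
      obtain ⟨rfl, e⟩ | ⟨hc, e⟩ := rightLeaves_node a b c
      · rw [e]
        by_cases hb : b = leaf
        · subst hb
          exact ⟨0, by simp [rightLeaves], fun y => .kink y⟩
        · obtain ⟨n, hn, hb⟩ := ihb hb
          exact ⟨n + 1, by omega, fun y => (hb y).turn⟩
      · rw [e]
        obtain ⟨n, hn, hc⟩ := ihc hc
        exact ⟨n + b.rightLeaves, by omega, fun y => hasPositiveForm_caret_of ihb y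
          (by simpa using hc (!y))⟩
    obtain ⟨m, hm, hM⟩ := hM
    refine ⟨m + a.rightLeaves, hm, fun x => hasPositiveForm_caret_of iha x ?_⟩
    simpa [BTree.vineTangle, binary] using hM (!x)

theorem hasPositiveForm_caret (A : TTree) (x : Bool) {s : List Bool} {w : List Slice} {m : ℕ}
    (hw : HasPositiveForm ((!x) :: s) [!x] w m) : HasPositiveForm (x :: s) [x]
      (topCaret x ++ shift 2 w ++ A.binary.vineTangle x) (m + A.rightLeaves) :=
  hasPositiveForm_caret_of A.hasPositiveForm_vineTangle x hw

/-- Here the last leaf has no vine caret of its own, so a third child that is a leaf costs nothing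
and needs neither `kink` nor `turn`. The bound is then not attained, which accounts for the
inequality. -/
theorem hasPositiveForm_vineClosure (U : TTree) (x : Bool) :
    HasPositiveForm [x] [x] (U.binary.vineClosure x) U.rightLeaves := by
  induction U generalizing x with
  | leaf => exact .of_signs rfl rfl
  | node a b c iha ihb ihc =>
    have h := ihc x
    rw [← Bool.not_not x] at h
    have := hasPositiveForm_caret a x (hasPositiveForm_caret b (!x) h)
    refine this.mono ?_
    obtain ⟨rfl, e⟩ | ⟨-, e⟩ := rightLeaves_node a b c
    · simp only [rightLeaves]; omega
    · omega

end TTree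
/-! ### The two halves of the diagram of a pair of trees -/

namespace BTree

/-- The upper half of the diagram, for a tree that hangs from the leftmost strand, where `x` is the
colour of its leftmost region. -/
def upper : Bool → BTree → List Slice
  | _, leaf => []
  | x, node l r => topCaret x ++ upper x l ++ shift (2 * l.leaves) (upper (!x) r)

/-- The lower half of the diagram, for a tree that hangs from the leftmost strand. -/
def lower : BTree → List Slice
  | leaf => []
  | node l r => shift (2 * l.leaves) (lower r) ++ lower l ++ botCaret

/-- The strands that leave the upper half of the diagram. -/
def level : Bool → BTree → List Bool
  | x, leaf => [x]
  | x, node l r => level x l ++ x :: level (!x) r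

theorem length_level (x : Bool) (T : BTree) : (T.level x).length + 1 = 2 * T.leaves := by
  induction T generalizing x with
  | leaf => rfl
  | node l r hl hr =>
    have := hl x
    have := hr (!x)
    simp only [level, leaves, List.length_append, List.length_cons]
    omega

theorem runs_upper (x : Bool) (T : BTree) : Runs (T.upper x) [x] (T.level x) := by
  induction T generalizing x with
  | leaf => exact Runs.nil _
  | node l r hl hr =>
    refine ((runs_topCaret x x []).append ((hl x).frame_right [x, !x])).append ?_
    have h := (hr (!x)).frame (l.level x ++ [x]) []
    rw [List.length_append, List.length_singleton, length_level] at h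
    simpa [level] using h

theorem runs_lower (x : Bool) (T : BTree) : Runs T.lower (T.level x) [x] := by
  induction T generalizing x with
  | leaf => exact Runs.nil _
  | node l r hl hr =>
    have h := (hr (!x)).frame (l.level x ++ [x]) []
    rw [List.length_append, List.length_singleton, length_level] at h
    refine Runs.append (Runs.append (t := l.level x ++ [x, !x]) (by simpa [level] using h)
      ((hl x).frame_right [x, !x])) (runs_botCaret x x [])

/-- A proper colouring keeps its value in passing to a left child and flips it in passing to a right
child, so the colour at the first leaf determines the whole word. -/
theorem topWord_eq_upper (c : ℕ → Bool) (T : BTree) (i j : ℕ)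
    (h : ∀ e ∈ T.taitEdges j, c e.2 = !c e.1) : T.topWord c i j = shift i (T.upper (c j)) := by
  induction T generalizing i j with
  | leaf => rfl
  | node l r hl hr =>
    simp only [taitEdges, List.mem_cons, List.mem_append] at h
    have h0 : c (j + l.leaves) = !c j := h (j, j + l.leaves) (Or.inl rfl)
    simp only [topWord, upper]
    rw [hl i j fun e he => h e (.inr (.inl he)),
      hr _ _ fun e he => h e (.inr (.inr he)), h0]
    simp [topCaret, shift_shift, Nat.add_comm]

theorem botWord_eq_lower (T : BTree) (i : ℕ) : T.botWord i = shift i T.lower := by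
  induction T generalizing i with
  | leaf => rfl
  | node l r hl hr =>
    simp only [botWord, lower]
    rw [hl, hr]
    simp [botCaret, shift_shift, Nat.add_comm]

/-- The strands that meet the line between the two trees, without the leftmost one. -/
theorem cons_level_eq_strands (c : ℕ → Bool) (T : BTree) (j : ℕ)
    (h : ∀ e ∈ T.taitEdges j, c e.2 = !c e.1) :
    (!c j) :: T.level (c j) = strands c j T.leaves := by
  have h1 := T.run_topWord c [] [] j h
  rw [topWord_eq_upper c T _ j h] at h1
  have h2 := (T.runs_upper (c j)).frame [!c j] []
  have h3 := Runs.unique h2 h1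
  simpa using h3

theorem level_getElem?_zero (x : Bool) (T : BTree) : (T.level x)[0]? = some x := by
  induction T generalizing x with
  | leaf => rfl
  | node l r hl hr =>
    have := length_level x l
    have := l.leaves_pos
    rw [level, List.getElem?_append_left (by omega), hl]

/-- A colouring of the vertices that agrees with the strands is proper. -/
theorem proper_of_level (c : ℕ → Bool) (x : Bool) (T : BTree) (j : ℕ)
    (h : ∀ k < T.leaves, (T.level x)[2 * k]? = some (c (j + k))) :
    ∀ e ∈ T.taitEdges j, c e.2 = !c e.1 := by
  induction T generalizing x j with
  | leaf => intro e he; simp [taitEdges] at he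
  | node l r hl hr =>
    simp only [leaves, level] at h
    have hlen := length_level x l
    have hlp := l.leaves_pos
    have hL : ∀ k < l.leaves, (l.level x)[2 * k]? = some (c (j + k)) := by
      intro k hk
      rw [← h k (by omega), List.getElem?_append_left (by omega)]
    have hR : ∀ k < r.leaves, (r.level (!x))[2 * k]? = some (c (j + l.leaves + k)) := by
      intro k hk
      rw [Nat.add_assoc, ← h (l.leaves + k) (by omega), List.getElem?_append_right (by omega),
        show 2 * (l.leaves + k) - (l.level x).length = 2 * k + 1 by omega,
        List.getElem?_cons_succ]
    intro e he
    simp only [taitEdges, List.mem_cons, List.mem_append] at he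
    obtain rfl | he | he := he
    · have h0 := hL 0 hlp
      have h1 := hR 0 r.leaves_pos
      rw [Nat.mul_zero, level_getElem?_zero] at h0 h1
      simp only [Nat.add_zero, Option.some.injEq] at h0 h1
      simp only [← h0, ← h1]
    · exact hl x j hL e he
    · exact hr _ _ hR e he

end BTree

namespace TreePair

/-- The Tait graph is bipartite if and only if the two halves of the diagram fit together. -/
theorem isOriented_iff (P : TreePair) : P.IsOriented ↔ P.top.level true = P.bot.level true := by
  constructor
  · intro h
    have h1 := P.top.cons_level_eq_strands (P.colour h) 0 fun e he => P.colour_edge h e (.inl he)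
    have h2 := P.bot.cons_level_eq_strands (P.colour h) 0 fun e he => P.colour_edge h e (.inr he)
    rw [← P.leaves_eq, ← h1, colour_zero] at h2
    exact (List.cons.inj h2).2.symm
  · intro h
    -- The even positions of the common level carry the colours of the regions. The default `true`
    -- is never read at a vertex of the graph.
    let c : ℕ → Bool := fun k => (P.top.level true).getD (2 * k) true
    have hc : ∀ k < P.top.leaves, (P.top.level true)[2 * k]? = some (c (0 + k)) := by
      intro k hk
      have := BTree.length_level true P.top
      have hk' : 2 * k < (P.top.level true).length := by omega
      simp [c, List.getD, hk']
    have h1 := P.top.proper_of_level c true 0 hc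
    have h2 := P.bot.proper_of_level c true 0
      (fun k hk => by rw [← h]; exact hc k (P.leaves_eq ▸ hk))
    have key : ∀ a b : Fin P.top.leaves, ((a : ℕ), (b : ℕ)) ∈ P.top.taitEdges 0 ∨
        ((a : ℕ), (b : ℕ)) ∈ P.bot.taitEdges 0 → c a ≠ c b := by
      intro a b hab
      have : c b = !c a := hab.elim (h1 _) (h2 _)
      simp [this]
    let C : P.tait.Coloring Bool := SimpleGraph.Coloring.mk (fun a => c a) (by
      intro a b hab
      rw [tait, SimpleGraph.fromRel_adj] at hab
      exact hab.2.elim (key a b) fun h => (key b a h).symm)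
    have := C.colorable
    rwa [Fintype.card_bool] at this

/-- The diagram of a pair of trees: the two halves, joined on the left. -/
def diagram (P : TreePair) : List Slice :=
  [⟨0, .birth false⟩] ++ shift 1 (P.top.upper true ++ P.bot.lower) ++ [⟨0, .death⟩]

/-- Eliminates the chosen colouring: only its value at the leftmost vertex enters, and this is `+`.
-/
theorem link_word (P : TreePair) (h : P.IsOriented) : (P.link h).word = P.diagram := by
  have h1 := P.top.topWord_eq_upper (P.colour h) 1 0 fun e he => P.colour_edge h e (.inl he)
  simp only [link, diagram]
  rw [h1, BTree.botWord_eq_lower, colour_zero]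
  simp

end TreePair

/-! ### Trees over a right vine -/

namespace BTree

/-- All left subtrees have an odd number of leaves. -/
def LeftOdd : BTree → Prop
  | leaf => True
  | node l r => Odd l.leaves ∧ l.LeftOdd ∧ r.LeftOdd

theorem level_vine_succ (x : Bool) (n : ℕ) :
    (vine (n + 1)).level x = x :: x :: (vine n).level (!x) := rfl

/-- The colours along a vine alternate, so after an odd number `2 * m + 1` of leaves the pattern
starts again with the opposite colour. -/
theorem level_vine_add (x : Bool) (m n : ℕ) :
    (vine (2 * m)).level x ++ x :: (vine n).level (!x) = (vine (2 * m + 1 + n)).level x := by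
  induction m with
  | zero => rw [Nat.mul_zero, Nat.zero_add, Nat.add_comm, level_vine_succ]; rfl
  | succ m ih =>
    rw [show 2 * (m + 1) + 1 + n = (2 * m + 1 + n) + 1 + 1 by omega,
      show 2 * (m + 1) = 2 * m + 1 + 1 by omega]
    simp only [level_vine_succ, Bool.not_not, List.cons_append, ih]

theorem level_of_leftOdd {T : BTree} (h : T.LeftOdd) (x : Bool) :
    T.level x = (vine (T.leaves - 1)).level x := by
  induction T generalizing x with
  | leaf => rfl
  | node l r hl hr =>
    obtain ⟨⟨m, hm⟩, h1, h2⟩ := h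
    have := r.leaves_pos
    simp only [level, leaves]
    rw [hl h1, hr h2, hm, Nat.add_sub_cancel, level_vine_add]
    congr 2
    omega

/-- The right subtree starts with colour `!x`, while the vine has colour `!x` only after an odd
number of leaves. -/
theorem leftOdd_of_level {T : BTree} {x : Bool} {n : ℕ} (h : T.level x = (vine n).level x) :
    T.LeftOdd := by
  have hlen : ∀ {T : BTree} {x : Bool} {n : ℕ} {s : List Bool},
      T.level x ++ s = (vine n).level x → T.leaves ≤ n + 1 := by
    intro T x n s h
    have h1 := congrArg List.length h
    have h2 := length_level x T
    have h3 := length_level x (vine n)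
    rw [leaves_vine] at h3
    rw [List.length_append] at h1
    omega
  -- The level of a left subtree is only a prefix of the level of a vine, so the induction has to
  -- allow a remainder `s`.
  suffices H : ∀ (x : Bool) (n : ℕ) (s : List Bool), T.level x ++ s = (vine n).level x →
      T.LeftOdd by
    exact H x n [] (by simpa using h)
  clear h x n
  induction T with
  | leaf => intros; trivial
  | node l r hl hr =>
    intro x n s h
    have hn := hlen h
    have hp := r.leaves_pos
    have hlp := l.leaves_pos
    simp only [leaves] at hn
    simp only [level, List.append_assoc, List.cons_append] at h
    have h1 := hl x n _ h
    have hodd : Odd l.leaves := by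
      by_contra hc
      obtain ⟨m, hm⟩ := Nat.not_odd_iff_even.mp hc
      obtain ⟨k, hk⟩ : ∃ k, n = 2 * (m - 1) + 1 + (1 + k) := ⟨n - 2 * m, by omega⟩
      -- With `2 * m` leaves in `l`, the strand following `l.level x` is `x` in the tree, but `!x`
      -- in the vine.
      have e1 : l.level x = (vine (2 * (m - 1) + 1 + 0)).level x := by
        rw [level_of_leftOdd h1, show l.leaves - 1 = 2 * (m - 1) + 1 + 0 by omega]
      rw [e1, hk, ← level_vine_add, ← level_vine_add, Nat.add_comm 1 k, level_vine_succ] at h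
      simp [vine, level] at h
    obtain ⟨m, hm⟩ := hodd
    refine ⟨⟨m, hm⟩, h1, hr (!x) (n - l.leaves) s ?_⟩
    obtain ⟨k, hk⟩ : ∃ k, n = 2 * m + 1 + k := ⟨n - l.leaves, by omega⟩
    rw [level_of_leftOdd h1, hm, Nat.add_sub_cancel, hk, ← level_vine_add] at h
    rw [hm, hk, Nat.add_sub_cancel_left]
    exact (List.cons.inj (List.append_cancel_left h)).2

/-- The left subtree is odd, so the right subtree has the opposite parity to `T`. The odd case takes
`B` and `C` from the even right subtree, the even case takes `B` from the odd one; hence both are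
proved together. -/
theorem exists_binary {T : BTree} (h : T.LeftOdd) :
    (Odd T.leaves → ∃ U : TTree, U.binary = T) ∧
      (Even T.leaves → ∃ A B : TTree, T = node A.binary B.binary) := by
  induction T with
  | leaf => exact ⟨fun _ => ⟨.leaf, rfl⟩, fun h => by simp [leaves] at h⟩
  | node l r hl hr =>
    obtain ⟨A, rfl⟩ := (hl h.2.1).1 h.1
    simp only [leaves]
    refine ⟨fun ho => ?_, fun he => ?_⟩
    · obtain ⟨B, C, rfl⟩ := (hr h.2.2).2 (by have := h.1; grind)
      exact ⟨.node A B C, rfl⟩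
    · obtain ⟨B, rfl⟩ := (hr h.2.2).1 (by have := h.1; grind)
      exact ⟨A, B, rfl⟩

theorem lower_vine_add (m n : ℕ) :
    (vine (m + n)).lower = shift (2 * m) (vine n).lower ++ (vine m).lower := by
  induction m with
  | zero => simp [vine, lower]
  | succ m ih =>
    rw [Nat.add_right_comm]
    simp only [vine, lower, ih, leaves, shift_append, shift_shift, List.append_assoc,
      List.nil_append]
    rfl

/-- The carets of the right vine below the right subtree are moved above the left subtree. -/
theorem isotopic_nest {l r : BTree} {x : Bool} {s : List Bool} {n : ℕ} {u v : List Slice}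
    (hl : Isotopic [x, x, !x] [x] (l.upper x ++ (vine l.leaves).lower) u)
    (hr : Isotopic ((!x) :: s) [!x] (r.upper (!x) ++ (vine n).lower) v) :
    Isotopic (x :: s) [x] ((node l r).upper x ++ (vine (l.leaves + n)).lower)
      (topCaret x ++ shift 2 v ++ u) := by
  have h1 : Isotopic (x :: x :: (!x) :: s) (l.level x ++ [x, !x])
      (l.upper x ++ shift (2 * l.leaves) (r.upper (!x) ++ (vine n).lower))
      (shift 2 (r.upper (!x) ++ (vine n).lower) ++ l.upper x) := by
    have := isotopic_interchange ((l.runs_upper x).frame_right [x]) hr.1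
    rw [List.length_append, List.length_singleton, length_level] at this
    simpa using this
  have h2 : Runs (vine l.leaves).lower (l.level x ++ [x, !x]) [x] := by
    obtain ⟨t, h, h'⟩ := Runs.append_iff.mp hl.1
    rwa [h.unique ((l.runs_upper x).frame_right [x, !x])] at h'
  have h3 := hr.frame_left [x, x]
  have e1 := Isotopic.append_left (runs_topCaret x x s) (h1.append_right h2)
  have e2 := Isotopic.append_left (runs_topCaret x x s) (h3.append hl)
  rw [lower_vine_add]
  simp only [upper, shift_append, List.append_assoc, List.length_cons, List.length_nil,
    Nat.zero_add, Nat.reduceAdd] at e1 e2 ⊢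
  exact e1.trans e2

/-- The vine with `T.leaves` carets has one leaf more than `T`. The list `s` holds the two strands
at this extra leaf, and `hs` says that they continue the level of `T` to that of the vine. -/
theorem isotopic_vineTangle {T : BTree} (h : T.LeftOdd) (x : Bool) (s : List Bool)
    (hs : T.level x ++ s = (vine T.leaves).level x) :
    Isotopic (x :: s) [x] (T.upper x ++ (vine T.leaves).lower) (T.vineTangle x) := by
  induction T generalizing x s with
  | leaf =>
    have : x :: s = [x, x, !x] := hs
    rw [this]
    exact .refl (runs_botCaret x x [])
  | node l r hl hr =>
    obtain ⟨⟨m, hm⟩, h1, h2⟩ := h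
    have e := level_of_leftOdd h1 x
    rw [hm, Nat.add_sub_cancel] at e
    refine isotopic_nest (hl h1 x [x, !x] ?_) (hr h2 (!x) s ?_)
    · rw [e, hm]
      exact level_vine_add x m 0
    · simp only [level, leaves, e, hm, ← level_vine_add, List.append_assoc] at hs
      exact (List.cons.inj (List.append_cancel_left hs)).2

theorem isotopic_vineClosure {T : BTree} (h : T.LeftOdd) (x : Bool) :
    Isotopic [x] [x] (T.upper x ++ (vine (T.leaves - 1)).lower) (T.vineClosure x) := by
  induction T generalizing x with
  | leaf => exact .refl (Runs.nil _)
  | node l r hl hr =>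
    obtain ⟨⟨m, hm⟩, h1, h2⟩ := h
    have e := level_of_leftOdd h1 x
    rw [hm, Nat.add_sub_cancel] at e
    have hp := r.leaves_pos
    rw [leaves, Nat.add_sub_assoc hp]
    refine isotopic_nest (isotopic_vineTangle h1 x [x, !x] ?_) (hr h2 (!x))
    rw [e, hm]
    exact level_vine_add x m 0

/-- A reduced top tree may have an even number of leaves and then is no binary transform. Descending
along the right spine, only its left subtrees have to be ternary, and these are odd. -/
theorem exists_hasPositiveForm_vineClosure {T : BTree} (h : T.LeftOdd) (x : Bool) :
    ∃ n, HasPositiveForm [x] [x] (T.vineClosure x) n := by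
  induction T generalizing x with
  | leaf => exact ⟨0, .of_signs rfl rfl⟩
  | node l r hl hr =>
    obtain ⟨A, rfl⟩ := (exists_binary h.2.1).1 h.1
    obtain ⟨n, hn⟩ := hr h.2.2 (!x)
    exact ⟨_, A.hasPositiveForm_caret x hn⟩

/-- The Tait edges of the vine join consecutive vertices, so the colours alternate; an edge of `T`
across a left leg with `p` leaves below it is then properly coloured if and only if `p` is odd. -/
theorem isOriented_toPair_iff (T : BTree) : T.toPair.IsOriented ↔ T.LeftOdd := by
  rw [TreePair.isOriented_iff]
  exact ⟨leftOdd_of_level, fun h => level_of_leftOdd h true⟩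

theorem hasPositiveForm_diagram {T : BTree} (h : T.LeftOdd) {n : ℕ}
    (hn : HasPositiveForm [true] [true] (T.vineClosure true) n) :
    HasPositiveForm [] [] T.toPair.diagram n := by
  have h1 := (hn.of_isotopic (isotopic_vineClosure h true)).frame [false] []
  have hb : HasPositiveForm [] [false, true] [⟨0, .birth false⟩] 0 := .of_signs rfl rfl
  have hd : HasPositiveForm [false, true] [] [⟨0, .death⟩] 0 := .of_signs rfl rfl
  exact ((hb.append h1).append hd).mono (by omega)

end BTree

theorem TreePair.exists_positive {P : TreePair} (h : P.IsOriented) {n : ℕ}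
    (hn : HasPositiveForm [] [] P.diagram n) :
    ∃ D : LinkDiagram, (P.link h).SameLink D ∧ D.IsPositive ∧ D.crossings ≤ n := by
  obtain ⟨w, hw, h1, h2⟩ := hn
  exact ⟨⟨w, hw.2.1⟩, LinkDiagram.sameLink_of_isotopic (by rwa [P.link_word]), h1, h2⟩
/-! ### Inserting a caret -/

namespace BTree

theorem graft_caretAt_of_lt {l r : BTree} {i : ℕ} (h : i < l.leaves) :
    (node l r).graft (caretAt i) = node (l.graft (caretAt i)) r := by
  have : (fun k => caretAt i (k + l.leaves)) = fun _ => leaf := by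
    funext k
    simp only [caretAt]
    rw [if_neg (by omega)]
  rw [graft, this, graft_leaf]

theorem graft_caretAt_of_le {l r : BTree} {i : ℕ} (h : l.leaves ≤ i) :
    (node l r).graft (caretAt i) = node l (r.graft (caretAt (i - l.leaves))) := by
  have h1 : l.graft (caretAt i) = l := by
    refine (graft_congr l fun k hk => ?_).trans (graft_leaf l)
    simp only [caretAt]
    rw [if_neg (by omega)]
  have h2 : (fun k => caretAt i (k + l.leaves)) = caretAt (i - l.leaves) := by
    funext k
    simp only [caretAt]
    congr 1
    apply propext
    omega
  rw [graft, h1, h2]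

theorem leaves_graft_caretAt {T : BTree} {i : ℕ} (h : i < T.leaves) :
    (T.graft (caretAt i)).leaves = T.leaves + 1 := by
  induction T generalizing i with
  | leaf =>
    obtain rfl : i = 0 := by simpa [leaves] using h
    rfl
  | node l r hl hr =>
    by_cases hi : i < l.leaves
    · rw [graft_caretAt_of_lt hi, leaves, leaves, hl hi]; omega
    · simp only [leaves] at h
      rw [graft_caretAt_of_le (by omega), leaves, leaves, hr (by omega)]; omega

/-- Inserting a caret in a tree amounts to adding a caret at the end of the upper half of its
diagram and at the start of the lower half. -/
theorem isotopic_graft_caretAt (T : BTree) (x : Bool) {i : ℕ} (hi : i < T.leaves) :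
    ∃ (l r : List Bool) (b : Bool), l.length = 2 * i ∧ T.level x = l ++ b :: r ∧
      (T.graft (caretAt i)).level x = l ++ b :: b :: (!b) :: r ∧
      Isotopic [x] ((T.graft (caretAt i)).level x) ((T.graft (caretAt i)).upper x)
        (T.upper x ++ shift (2 * i) (topCaret b)) ∧
      Isotopic ((T.graft (caretAt i)).level x) [x] (T.graft (caretAt i)).lower
        (shift (2 * i) botCaret ++ T.lower) := by
  induction T generalizing x i with
  | leaf =>
    obtain rfl : i = 0 := by simpa [leaves] using hi
    exact ⟨[], [], x, rfl, rfl, rfl, .refl (runs_topCaret x x []), .refl (runs_botCaret x x [])⟩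
  | node L R hL hR =>
    by_cases h : i < L.leaves
    · obtain ⟨l, r, b, hl, e, e', hu, hd⟩ := hL x h
      have hlen := leaves_graft_caretAt h
      rw [graft_caretAt_of_lt h]
      refine ⟨l, r ++ x :: R.level (!x), b, hl, by simp [level, e], by simp [level, e'], ?_, ?_⟩
      · have hc : Runs (shift (2 * i) (topCaret b)) (L.level x ++ [x])
            ((L.graft (caretAt i)).level x ++ [x]) := by
          rw [e, e', ← hl]
          simpa using (runs_topCaret b b (r ++ [x])).frame l []
        -- The new caret lies below `L` and has to be moved past the diagram of `R` to reach the end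
        -- of the upper half.
        have h1 := isotopic_interchange hc (R.runs_upper (!x))
        rw [List.length_append, List.length_append, List.length_singleton, length_level,
          length_level, hlen] at h1
        have hR' := ((R.runs_upper (!x)).frame ((L.graft (caretAt i)).level x ++ [x]) [])
        rw [List.length_append, List.length_singleton, length_level, hlen] at hR'
        have h2 := Isotopic.append_left (runs_topCaret x x [])
          ((hu.frame_right [x, !x]).append_right (t := (node (L.graft (caretAt i)) R).level x)
            (by simpa [level] using hR'))
        have h3 := Isotopic.append_left ((runs_topCaret x x []).append
          ((L.runs_upper x).frame_right [x, !x])) (t := (node (L.graft (caretAt i)) R).level x)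
            (by simpa [level] using h1)
        simp only [upper, hlen, List.append_assoc] at h2 h3 ⊢
        exact h2.trans h3
      · have hc : Runs (shift (2 * i) botCaret) ((L.graft (caretAt i)).level x ++ [x])
            (L.level x ++ [x]) := by
          rw [e, e', ← hl]
          simpa using (runs_botCaret b b (r ++ [x])).frame l []
        have h1 := (isotopic_interchange hc (R.runs_lower (!x))).symm
        rw [List.length_append, List.length_append, List.length_singleton, length_level,
          length_level, hlen] at h1
        have hR' := ((R.runs_lower (!x)).frame ((L.graft (caretAt i)).level x ++ [x]) [])
        rw [List.length_append, List.length_singleton, length_level, hlen] at hR'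
        have h2 := Isotopic.append_left (s := (node (L.graft (caretAt i)) R).level x)
          (by simpa [level] using hR') ((hd.frame_right [x, !x]).append_right
            (runs_botCaret x x []))
        have h3 := Isotopic.append_right (s := (node (L.graft (caretAt i)) R).level x)
          (r := L.level x ++ [x, !x]) (by simpa [level] using h1)
          (((L.runs_lower x).frame_right [x, !x]).append (runs_botCaret x x []))
        simp only [lower, hlen, List.append_assoc] at h2 h3 ⊢
        exact h2.trans h3
    · simp only [leaves] at hi
      obtain ⟨l, r, b, hl, e, e', hu, hd⟩ := hR (!x) (i := i - L.leaves) (by omega)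
      have hi' : 2 * (i - L.leaves) + 2 * L.leaves = 2 * i := by omega
      rw [graft_caretAt_of_le (by omega)]
      refine ⟨L.level x ++ x :: l, r, b, ?_, by simp [level, e], by simp [level, e'], ?_, ?_⟩
      · have := length_level x L
        simp only [List.length_append, List.length_cons, hl]
        omega
      · have h1 := hu.frame_left (L.level x ++ [x])
        rw [List.length_append, List.length_singleton, length_level, shift_append, shift_shift,
          hi'] at h1
        have h2 := Isotopic.append_left ((runs_topCaret x x []).append
          ((L.runs_upper x).frame_right [x, !x]))
            (t := (node L (R.graft (caretAt (i - L.leaves)))).level x)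
            (by simpa [level] using h1)
        simpa only [upper, List.append_assoc] using h2
      · have h1 := hd.frame_left (L.level x ++ [x])
        rw [List.length_append, List.length_singleton, length_level, shift_append, shift_shift,
          hi'] at h1
        have h2 := Isotopic.append_right
          (s := (node L (R.graft (caretAt (i - L.leaves)))).level x) (r := L.level x ++ [x, !x])
          (by simpa [level] using h1)
          (((L.runs_lower x).frame_right [x, !x]).append (runs_botCaret x x []))
        simpa only [lower, List.append_assoc] using h2

end BTree

/-! ### Unknotted components -/

/-- A circle without crossings. -/
def circle (b : Bool) : List Slice := [⟨0, .birth b⟩, ⟨0, .death⟩]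

theorem runs_circle (b : Bool) : Runs (circle b) [] [] := by
  simp [circle, Runs, runSlices, Slice.apply]

/-- The circle passes under one strand at a time; this is the overpass isotopy for a tangle without
endpoints. -/
theorem isotopic_shift_circle (b : Bool) (s : List Bool) :
    Isotopic s s (shift s.length (circle b)) (circle b) := by
  induction s with
  | nil => rw [List.length_nil, shift_zero]; exact .refl (runs_circle b)
  | cons y s ih =>
    have h1 : Isotopic (y :: s) (y :: s) (shift (s.length + 1) (circle b))
        (shift 1 (circle b)) := by
      simpa [shift_shift] using ih.frame_left [y]
    have h2 : Isotopic (y :: s) (y :: s) (circle b) (shift 1 (circle b)) := by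
      simpa [overpass] using (isotopic_overpass y (runs_circle b)).frame_right s
    exact h1.trans h2.symm

/-- A circle is moved away from a diagram. -/
theorem isotopic_move_circle (b : Bool) {u : List Slice} {s l r : List Bool}
    (h : Runs u s (l ++ r)) :
    Isotopic s (l ++ r) (u ++ shift l.length (circle b)) (circle b ++ u) := by
  have h1 := (isotopic_shift_circle b l).frame_right r
  have h2 := isotopic_shift_circle b (l ++ r)
  have h3 := isotopic_interchange h (runs_circle b)
  have h4 := (isotopic_shift_circle b s).append_right h
  simp only [List.append_nil] at h3
  exact (Isotopic.append_left h (h1.trans h2.symm)).trans (h3.trans h4)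

/-! ### Inserting a pair of opposing carets -/

namespace TreePair

/-- In both levels the strand `b` at position `2 * i` is replaced by `b, b, !b`, so the levels agree
after the insertion if and only if they agreed before. -/
theorem isOriented_graft_caretAt {P : TreePair} {i : ℕ} (hi : i < P.top.leaves) :
    (P.graft (BTree.caretAt i)).IsOriented ↔ P.IsOriented := by
  obtain ⟨l, r, b, hl, e, e', -⟩ := P.top.isotopic_graft_caretAt true hi
  obtain ⟨l', r', b', hl', f, f', -⟩ :=
    P.bot.isotopic_graft_caretAt true (hi.trans_eq P.leaves_eq)
  simp only [isOriented_iff, graft, e, e', f, f']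
  have hll : l.length = l'.length := hl.trans hl'.symm
  rw [List.append_eq_append_iff_of_size_eq_left hll,
    List.append_eq_append_iff_of_size_eq_left hll]
  simp only [List.cons.injEq]
  constructor
  · rintro ⟨h, hb, -, -, hr⟩
    exact ⟨h, hb, hr⟩
  · rintro ⟨h, rfl, hr⟩
    exact ⟨h, rfl, rfl, rfl, hr⟩

theorem isOriented_congr {P Q : TreePair} (h : P ≈ Q) : P.IsOriented ↔ Q.IsOriented := by
  change Relation.EqvGen AddCarets P Q at h
  induction h with
  | rel P Q h =>
    obtain ⟨i, hi, rfl⟩ := h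
    exact (isOriented_graft_caretAt hi).symm
  | refl => exact Iff.rfl
  | symm _ _ _ ih => exact ih.symm
  | trans _ _ _ _ _ ih ih' => exact ih.trans ih'

/-- The two opposing carets meet at the line between the trees and form a closed curve over one
strand. It slides off as a circle, which is moved out of the diagram. -/
theorem hasPositiveForm_diagram_graft_caretAt {P : TreePair} (hP : P.IsOriented) {i n : ℕ}
    (hi : i < P.top.leaves) (h : HasPositiveForm [] [] P.diagram n) :
    HasPositiveForm [] [] (P.graft (BTree.caretAt i)).diagram n := by
  have hQ := (isOriented_graft_caretAt hi).mpr hP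
  rw [isOriented_iff] at hP hQ
  obtain ⟨l, r, b, hl, e, e', hu, -⟩ := P.top.isotopic_graft_caretAt true hi
  obtain ⟨-, -, -, -, -, -, -, hd⟩ :=
    P.bot.isotopic_graft_caretAt true (hi.trans_eq P.leaves_eq)
  have hlo := P.bot.runs_lower true
  simp only [graft] at hQ
  rw [← hQ] at hd
  rw [← hP, e] at hlo
  have hup := P.top.runs_upper true
  rw [e] at hup
  rw [e'] at hu hd
  have hc : Isotopic (l ++ b :: r) (l ++ b :: r)
      (shift (2 * i) (topCaret b) ++ shift (2 * i) botCaret)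
      (shift (l ++ [b]).length (circle b)) := by
    have := (isotopic_slide_arc b b (Runs.nil ((!b) :: r))).frame_left l
    rw [hl] at this
    simpa [hl, circle, shift, Nat.add_comm] using this
  have h1 := hu.append hd
  have h2 := Isotopic.append_left hup (hc.append_right hlo)
  have h3 := (isotopic_move_circle b (l := l ++ [b]) (r := r) (s := [true])
    (by simpa using hup)).append_right (w := P.bot.lower) (t := [true]) (by simpa using hlo)
  simp only [List.append_assoc] at h1 h2 h3
  have h4 := (h1.trans (h2.trans h3)).frame [false] []
  have hb : Runs [⟨0, .birth false⟩] [] [false, true] := rfl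
  have hdeath : Runs [⟨0, .death⟩] [false, true] [] := rfl
  have h5 := (Isotopic.append_left hb h4).append_right hdeath
  -- The circle still has to leave the region enclosed by the arc that joins the two roots.
  have h6 : Isotopic [] [false, true] ([⟨0, .birth false⟩] ++ shift 1 (circle b))
      (circle b ++ [⟨0, .birth false⟩]) :=
    isotopic_move_circle b (l := [false]) (r := [true]) hb
  have h7 := h6.append_right (((hup.append hlo).frame [false] []).append hdeath)
  have hcirc : HasPositiveForm [] [] (circle b) 0 := by
    cases b <;> exact .of_signs rfl rfl
  refine ((hcirc.append h).mono (Nat.zero_add n).le).of_isotopic ?_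
  simp only [diagram, graft, shift_append, List.append_assoc, List.length_singleton] at h5 h7 ⊢
  exact h5.trans h7

end TreePair

/-! ### Reduced pairs of trees -/

namespace BTree

theorem exists_node_of_one_lt {T : BTree} (h : 1 < T.leaves) : ∃ l r, T = node l r := by
  cases T with
  | leaf => simp [leaves] at h
  | node l r => exact ⟨l, r, rfl⟩

theorem graft_caretAt_injective {A B : BTree} {i : ℕ} (hA : i < A.leaves) (hB : i < B.leaves)
    (h : A.graft (caretAt i) = B.graft (caretAt i)) : A = B := by
  have hlen : A.leaves = B.leaves := by
    have := congrArg leaves h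
    rw [leaves_graft_caretAt hA, leaves_graft_caretAt hB] at this
    omega
  induction A generalizing B i with
  | leaf =>
    cases B with
    | leaf => rfl
    | node c d =>
      have := c.leaves_pos
      have := d.leaves_pos
      simp only [leaves] at hlen
      omega
  | node a b iha ihb =>
    cases B with
    | leaf =>
      have := a.leaves_pos
      have := b.leaves_pos
      simp only [leaves] at hlen
      omega
    | node c d =>
      simp only [leaves] at hA hB
      by_cases ha : i < a.leaves <;> by_cases hc : i < c.leaves
      · rw [graft_caretAt_of_lt ha, graft_caretAt_of_lt hc, node.injEq] at h
        have e := congrArg leaves h.1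
        rw [leaves_graft_caretAt ha, leaves_graft_caretAt hc] at e
        rw [iha ha hc h.1 (by omega), h.2]
      · rw [graft_caretAt_of_lt ha, graft_caretAt_of_le (by omega), node.injEq] at h
        have e := congrArg leaves h.1
        rw [leaves_graft_caretAt ha] at e
        omega
      · rw [graft_caretAt_of_le (by omega), graft_caretAt_of_lt hc, node.injEq] at h
        have e := congrArg leaves h.1
        rw [leaves_graft_caretAt hc] at e
        omega
      · rw [graft_caretAt_of_le (by omega), graft_caretAt_of_le (by omega), node.injEq] at h
        obtain ⟨rfl, h⟩ := h
        have e := congrArg leaves h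
        rw [leaves_graft_caretAt (by omega), leaves_graft_caretAt (by omega)] at e
        rw [ihb (by omega) (by omega) h (by omega)]

/-- Two different carets of a tree can be removed one after the other. -/
theorem exists_graft_caretAt {A B : BTree} {i j : ℕ} (hij : i < j) (hA : i < A.leaves)
    (hB : j < B.leaves) (h : A.graft (caretAt i) = B.graft (caretAt j)) :
    ∃ W : BTree, W.leaves + 1 = A.leaves ∧ A = W.graft (caretAt (j - 1)) ∧
      B = W.graft (caretAt i) := by
  have hlen : A.leaves = B.leaves := by
    have := congrArg leaves h
    rw [leaves_graft_caretAt hA, leaves_graft_caretAt hB] at this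
    omega
  induction A generalizing B i j with
  | leaf => simp only [leaves] at hlen; omega
  | node a b iha ihb =>
    obtain ⟨c, d, rfl⟩ := exists_node_of_one_lt (T := B) (by omega)
    simp only [leaves] at hA hB hlen
    by_cases ha : i < a.leaves <;> by_cases hc : j < c.leaves
    · rw [graft_caretAt_of_lt ha, graft_caretAt_of_lt hc, node.injEq] at h
      have e := congrArg leaves h.1
      rw [leaves_graft_caretAt ha, leaves_graft_caretAt hc] at e
      obtain ⟨W, hW, rfl, rfl⟩ := iha hij ha hc h.1 (by omega)
      obtain ⟨-, rfl⟩ := h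
      refine ⟨node W b, by simp only [leaves]; omega, ?_, ?_⟩
      · rw [graft_caretAt_of_lt (by omega)]
      · rw [graft_caretAt_of_lt (by omega)]
    · rw [graft_caretAt_of_lt ha, graft_caretAt_of_le (by omega), node.injEq] at h
      obtain ⟨rfl, rfl⟩ := h
      rw [leaves_graft_caretAt ha] at hc hlen hB ⊢
      refine ⟨node a d, ?_, ?_, ?_⟩
      · simp only [leaves]
        rw [leaves_graft_caretAt (by omega)]
        omega
      · rw [graft_caretAt_of_le (by omega), Nat.sub_sub, Nat.add_comm 1]
      · rw [graft_caretAt_of_lt ha]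
    · rw [graft_caretAt_of_le (by omega), graft_caretAt_of_lt hc, node.injEq] at h
      have e := congrArg leaves h.1
      rw [leaves_graft_caretAt hc] at e
      omega
    · rw [graft_caretAt_of_le (by omega), graft_caretAt_of_le (by omega), node.injEq] at h
      obtain ⟨rfl, h⟩ := h
      obtain ⟨W, hW, rfl, rfl⟩ := ihb (by omega) (by omega) (by omega) h (by omega)
      refine ⟨node a W, by simp only [leaves]; omega, ?_, ?_⟩
      · rw [graft_caretAt_of_le (by omega), Nat.sub_right_comm]
      · rw [graft_caretAt_of_le (by omega)]

/-- Ensures that the class of pairs over a right vine is closed under reduction: the only removable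
caret of a vine is its last one. -/
theorem eq_vine_of_graft_caretAt {T : BTree} {i n : ℕ} (hi : i < T.leaves)
    (h : T.graft (caretAt i) = vine n) : T = vine (T.leaves - 1) := by
  induction T generalizing i n with
  | leaf => rfl
  | node l r hl hr =>
    cases n with
    | zero =>
      have := congrArg leaves h
      rw [leaves_graft_caretAt hi] at this
      have := (node l r).leaves_pos
      simp only [vine, leaves] at *
      omega
    | succ n =>
      simp only [leaves] at hi
      by_cases hil : i < l.leaves
      · rw [graft_caretAt_of_lt hil, vine, node.injEq] at h
        have := congrArg leaves h.1
        rw [leaves_graft_caretAt hil] at this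
        simp only [leaves] at this
        omega
      · rw [graft_caretAt_of_le (by omega), vine, node.injEq] at h
        obtain ⟨rfl, h⟩ := h
        have e := hr (by omega) h
        have hp := r.leaves_pos
        rw [leaves, leaves, Nat.add_sub_cancel_left]
        obtain ⟨k, hk⟩ : ∃ k, r.leaves = k + 1 := ⟨r.leaves - 1, by omega⟩
        rw [hk, Nat.add_sub_cancel] at e
        rw [hk, vine, ← e]

theorem vine_graft_caretAt (n : ℕ) : (vine n).graft (caretAt n) = vine (n + 1) := by
  induction n with
  | zero => rfl
  | succ n ih =>
    rw [vine, graft_caretAt_of_le (by simp [leaves])]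
    simp only [leaves, Nat.add_sub_cancel, ih]
    rfl

end BTree

namespace TreePair

/-- The diamond property of reduction: two removals at different leaves commute, and the carets to
be removed have the same positions in both trees. -/
theorem exists_of_addCarets {P Q R : TreePair} (hP : P.AddCarets R) (hQ : Q.AddCarets R) :
    P = Q ∨ ∃ W : TreePair, W.AddCarets P ∧ W.AddCarets Q := by
  have key : ∀ {P Q R : TreePair} {i j : ℕ}, i < P.top.leaves → j < Q.top.leaves →
      R = P.graft (BTree.caretAt i) → R = Q.graft (BTree.caretAt j) → i < j →
      ∃ W : TreePair, W.AddCarets P ∧ W.AddCarets Q := by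
    intro P Q R i j hi hj h h' hij
    have e := h.symm.trans h'
    have e1 := congrArg top e
    have e2 := congrArg bot e
    have l1 := congrArg BTree.leaves e1
    simp only [graft] at e1 e2 l1
    rw [BTree.leaves_graft_caretAt hi, BTree.leaves_graft_caretAt hj] at l1
    obtain ⟨W, hW, a1, a2⟩ := BTree.exists_graft_caretAt hij hi hj e1
    obtain ⟨W', hW', b1, b2⟩ := BTree.exists_graft_caretAt hij (hi.trans_eq P.leaves_eq)
      (hj.trans_eq Q.leaves_eq) e2
    have hl : W.leaves = W'.leaves := by
      have := P.leaves_eq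
      omega
    exact ⟨⟨W, W', hl⟩, ⟨j - 1, by simp only; omega, ext' a1 b1⟩,
      ⟨i, by simp only; omega, ext' a2 b2⟩⟩
  obtain ⟨i, hi, h⟩ := hP
  obtain ⟨j, hj, h'⟩ := hQ
  obtain hij | rfl | hij := lt_trichotomy i j
  · exact .inr (key hi hj h h' hij)
  · refine .inl (ext' ?_ ?_)
    · exact BTree.graft_caretAt_injective hi hj (congrArg top (h.symm.trans h'))
    · exact BTree.graft_caretAt_injective (hi.trans_eq P.leaves_eq) (hj.trans_eq Q.leaves_eq)
        (congrArg bot (h.symm.trans h'))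
  · obtain ⟨W, h1, h2⟩ := key hj hi h' h hij
    exact .inr ⟨W, h2, h1⟩

/-- Equivalent pairs of trees have a common reduction. -/
theorem join_of_equiv {P Q : TreePair} (h : P ≈ Q) :
    Relation.Join (Relation.ReflTransGen fun P Q => AddCarets Q P) P Q := by
  -- By the Church–Rosser theorem the diamond property makes joinability an equivalence relation,
  -- and it contains the generators.
  have E := Relation.equivalence_join_reflTransGen (r := fun P Q => AddCarets Q P) (by
    intro R P Q hP hQ
    obtain rfl | ⟨W, hW, hW'⟩ := exists_of_addCarets hP hQ
    · exact ⟨P, .refl, .refl⟩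
    · exact ⟨W, .single hW, .single hW'⟩)
  change Relation.EqvGen AddCarets P Q at h
  induction h with
  | rel P Q h => exact ⟨P, .refl, .single h⟩
  | refl P => exact E.refl P
  | symm _ _ _ ih => exact E.symm ih
  | trans _ _ _ _ _ ih ih' => exact E.trans ih ih'

theorem eq_toPair_of_bot {P : TreePair} {n : ℕ} (h : P.bot = BTree.vine n) :
    P = P.top.toPair := by
  refine ext' rfl ?_
  simp only [BTree.toPair, P.leaves_eq, h, BTree.leaves_vine, Nat.add_sub_cancel]

theorem exists_toPair_of_reflTransGen {T : BTree} {P : TreePair}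
    (h : Relation.ReflTransGen (fun P Q => AddCarets Q P) T.toPair P) :
    ∃ S : BTree, P = S.toPair := by
  induction h with
  | refl => exact ⟨T, rfl⟩
  | tail _ h ih =>
    obtain ⟨S, rfl⟩ := ih
    obtain ⟨i, hi, h⟩ := h
    exact ⟨_, eq_toPair_of_bot (BTree.eq_vine_of_graft_caretAt (hi.trans_eq (leaves_eq _))
      (congrArg bot h).symm)⟩

theorem hasPositiveForm_diagram_of_reflTransGen {P Q : TreePair} {n : ℕ} (hQ : Q.IsOriented)
    (h : Relation.ReflTransGen (fun P Q => AddCarets Q P) P Q)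
    (hn : HasPositiveForm [] [] Q.diagram n) :
    P.IsOriented ∧ HasPositiveForm [] [] P.diagram n := by
  induction h using Relation.ReflTransGen.head_induction_on with
  | refl => exact ⟨hQ, hn⟩
  | head h _ ih =>
    obtain ⟨i, hi, rfl⟩ := h
    exact ⟨(isOriented_graft_caretAt hi).mpr ih.1,
      hasPositiveForm_diagram_graft_caretAt ih.1 hi ih.2⟩

end TreePair

/-! ### Positive elements -/

namespace ThompsonF

open BTree

theorem mk_graft_caretAt_last (T : BTree) :
    mk (T.graft (caretAt (T.leaves - 1))).toPair = mk T.toPair := by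
  have hp := T.leaves_pos
  have : (T.graft (caretAt (T.leaves - 1))).toPair
      = T.toPair.graft (caretAt (T.leaves - 1)) := by
    refine TreePair.ext' rfl ?_
    simp only [toPair, TreePair.graft]
    rw [vine_graft_caretAt, leaves_graft_caretAt (by omega)]
    congr 1
    omega
  rw [this]
  exact (mk_eq.mpr (TreePair.equiv_graft _ _)).symm

theorem exists_large (T : BTree) (N : ℕ) :
    ∃ S : BTree, mk S.toPair = mk T.toPair ∧ N < S.leaves := by
  induction N with
  | zero => exact ⟨T, rfl, T.leaves_pos⟩
  | succ N ih =>
    obtain ⟨S, hS, hN⟩ := ih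
    have hp := S.leaves_pos
    exact ⟨_, (mk_graft_caretAt_last S).trans hS, by
      rw [leaves_graft_caretAt (by omega)]; omega⟩

/-- Expanding `x_i` turns its top tree into a vine with one additional caret at leaf `i`, so right
multiplication by `x_i` hangs a caret on leaf `i` of the top tree over a large enough vine. -/
theorem exists_graft_genPair (i k : ℕ) : ∃ f : ℕ → BTree,
    (genPair i).top.graft f = (vine (i + 1 + k)).graft (caretAt i) ∧
      (genPair i).bot.graft f = vine (i + 1 + k + 1) := by
  induction i with
  | zero =>
    -- The rest of the vine hangs from the last of the three leaves of `x_0`.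
    refine ⟨fun j => if j = 2 then vine k else leaf, ?_, ?_⟩
    · rw [Nat.zero_add, Nat.add_comm 1 k, vine, graft_caretAt_of_lt (by simp [leaves])]
      simp [genPair, graft, leaves, caretAt]
    · rw [Nat.zero_add, Nat.add_comm 1 k]
      simp [genPair, graft, leaves, vine]
  | succ i ih =>
    obtain ⟨f, h1, h2⟩ := ih
    refine ⟨fun j => j.casesOn leaf f, ?_, ?_⟩
    · rw [Nat.add_right_comm (i + 1) 1 k, vine, graft_caretAt_of_le (by simp [leaves])]
      simp [genPair, graft, leaves, h1]
    · rw [Nat.add_right_comm (i + 1) 1 k, vine]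
      simp [genPair, graft, leaves, h2]

/-- Positive elements are described by pairs of trees whose bottom tree is a right vine. -/
theorem exists_toPair_of_mem_positive {g : ThompsonF} (h : g ∈ positive) :
    ∃ T : BTree, mk T.toPair = g := by
  induction h using Submonoid.closure_induction_right with
  | one => exact ⟨leaf, rfl⟩
  | mul_right g _ y hy ih =>
    obtain ⟨T, rfl⟩ := ih
    obtain ⟨i, rfl⟩ := hy
    -- With at least `i + 2` leaves the vine below `S` has the form `vine (i + 1 + k)`, which
    -- matches the top tree of the expanded `x_i` once a caret is inserted at leaf `i`.
    obtain ⟨S, hS, hi⟩ := exists_large T (i + 1)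
    obtain ⟨k, hk⟩ : ∃ k, S.leaves = i + 1 + k + 1 := ⟨S.leaves - (i + 2), by omega⟩
    obtain ⟨f, h1, h2⟩ := exists_graft_genPair i k
    have hl := leaves_graft_caretAt (T := S) (i := i) (by omega)
    have hv : ((vine (i + 1 + k)).graft (caretAt i)).leaves = i + 1 + k + 1 + 1 := by
      rw [leaves_graft_caretAt (by rw [leaves_vine]; omega), leaves_vine]
    refine ⟨S.graft (caretAt i), ?_⟩
    have e1 : mk T.toPair = mk ⟨S.graft (caretAt i), (vine (i + 1 + k)).graft (caretAt i), by
        rw [hl, hv, hk]⟩ := by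
      rw [← hS]
      refine (mk_eq.mpr (TreePair.equiv_graft _ (caretAt i))).trans
        (congrArg mk (TreePair.ext' rfl ?_))
      simp only [TreePair.graft, toPair, hk, Nat.add_sub_cancel]
    have e2 : x i = mk ⟨(vine (i + 1 + k)).graft (caretAt i), vine (i + 1 + k + 1), by
        rw [hv, leaves_vine]⟩ :=
      (mk_eq.mpr (TreePair.equiv_graft _ f)).trans (congrArg mk (TreePair.ext' h1 h2))
    rw [e1, e2, mk_mul_mk]
    refine congrArg mk (TreePair.ext' rfl ?_)
    simp only [toPair, hl, hk, Nat.add_sub_cancel]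

end ThompsonF

/-- Let `g` be a positive element of the oriented Thompson group. The oriented link of every pair
of trees that describes `g` has a positive diagram. Moreover, `g` is described by a pair whose
top tree is the binary transform of a ternary tree `U` and whose bottom tree is the right vine,
and the oriented link of each such pair has a positive diagram with at most as many crossings
as `U` has right leaves. -/
theorem theorem1 (g : ThompsonF) (hpos : g ∈ ThompsonF.positive) (hor : g ∈ ThompsonF.oriented) :
    (∀ P : TreePair, ThompsonF.mk P = g → ∃ h : P.IsOriented,
      ∃ D : LinkDiagram, (P.link h).SameLink D ∧ D.IsPositive) ∧
    (∃ U : TTree, ThompsonF.mk U.binary.toPair = g) ∧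
    (∀ U : TTree, ThompsonF.mk U.binary.toPair = g → ∃ h : U.binary.toPair.IsOriented,
      ∃ D : LinkDiagram, (U.binary.toPair.link h).SameLink D ∧ D.IsPositive ∧
        D.crossings ≤ U.rightLeaves) := by
  obtain ⟨T, hT⟩ := ThompsonF.exists_toPair_of_mem_positive hpos
  obtain ⟨Q, hQ, hQor⟩ := hor
  have oriented : ∀ {P : TreePair}, ThompsonF.mk P = g → P.IsOriented := fun hP =>
    (TreePair.isOriented_congr (ThompsonF.mk_eq.mp (hP.trans hQ.symm))).mpr hQor
  have leftOdd : ∀ {S : BTree}, ThompsonF.mk S.toPair = g → S.LeftOdd := fun hS =>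
    (BTree.isOriented_toPair_iff _).mp (oriented hS)
  refine ⟨fun P hP => ?_, ?_, fun U hU => ?_⟩
  -- The common reduction `W` of `P` and the pair over a vine is itself over a vine, and `P` arises
  -- from it by inserting carets.
  · obtain ⟨W, hPW, hTW⟩ := TreePair.join_of_equiv (ThompsonF.mk_eq.mp (hP.trans hT.symm))
    obtain ⟨S, rfl⟩ := TreePair.exists_toPair_of_reflTransGen hTW
    have hS : S.LeftOdd := by
      rw [← BTree.isOriented_toPair_iff]
      refine (TreePair.isOriented_congr ?_).mpr (oriented hP)
      clear hTW hP
      induction hPW using Relation.ReflTransGen.head_induction_on with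
      | refl => exact Setoid.refl _
      | head h _ ih => exact Setoid.trans ih (Relation.EqvGen.rel _ _ h)
    obtain ⟨n, hn⟩ := BTree.exists_hasPositiveForm_vineClosure hS true
    obtain ⟨h, h'⟩ := TreePair.hasPositiveForm_diagram_of_reflTransGen
      ((BTree.isOriented_toPair_iff S).mpr hS) hPW (BTree.hasPositiveForm_diagram hS hn)
    obtain ⟨D, hD, hD', -⟩ := TreePair.exists_positive h h'
    exact ⟨h, D, hD, hD'⟩
  · by_cases hodd : Odd T.leaves
    · obtain ⟨U, rfl⟩ := (BTree.exists_binary (leftOdd hT)).1 hodd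
      exact ⟨U, hT⟩
    -- Opposing carets at the last leaf keep the bottom tree a right vine and make the number of
    -- leaves odd.
    · have hT' := (ThompsonF.mk_graft_caretAt_last T).trans hT
      have hp := T.leaves_pos
      obtain ⟨U, hU⟩ := (BTree.exists_binary (leftOdd hT')).1 (by
        rw [BTree.leaves_graft_caretAt (by omega)]
        exact (Nat.not_odd_iff_even.mp hodd).add_one)
      exact ⟨U, by rw [hU]; exact hT'⟩
  · exact ⟨oriented hU, TreePair.exists_positive _
      (BTree.hasPositiveForm_diagram (leftOdd hU) (U.hasPositiveForm_vineClosure true))⟩
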